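/- **Definitions.** An effect algebra $(E;\oplus,0,1)$ is ordered by $a\le b\iff\exists c:\ a\oplus c=b$; $a'$ is the element with $a\oplus a'=1$; $a,b$ are Mackey compatible ($a\leftrightarrow b$) if $a=a_1\oplus c$, $b=b_1\oplus c$ with $a_1\oplus b_1\oplus c$ defined. An additive map $J:E\to E$ is a *compression* if $a\le J(1)$ implies $J(a)=a$, and $J(a)=0\iff a\le J(1)'$. A *compression base* is a family $(J_p)_{p\in P}$ of compressions, indexed by a sub-effect algebra $P\subseteq E$, with $J_p(1)=p$ and such that for all Mackey compatible $p,q\in P$ there is $r\in P$ with $J_p\circ J_q=J_r$. Put $C(p)=\{a: a=J_p(a)\oplus J_{p'}(a)\}$, $PC(A)=\{p\in P: A\subseteq C(p)\}$, $P(A)=PC(PC(A)\cup A)$, $P(a)=P(\{a\})$, $P(e,f)=P(\{e,f\})$. $E$ is *spectral* with respect to $(J_p)_{p\in P}$ if * (b-property) for each $a\in E$ there is a Boolean subalgebra $B\subseteq P$ such that for all $p\in P$: $a\in C(p)\iff B\subseteq C(p)$; * whenever all elements of $P(e)$ are Mackey compatible with all elements of $P(f)$, there is $p\in P(e,f)$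 with $J_p(e)\le J_p(f)$ and $J_{p'}(f)\le J_{p'}(e)$; * (projection cover) for each $a\in E$ there is $p\in P$ such that for all $q\in P$: $a\le q\iff p\le q$. $E$ is *convex* if it carries a multiplication by scalars $\lambda\in[0,1]$ with $\mu(\lambda a)=(\lambda\mu)a$, $(\lambda+\mu)a=\lambda a\oplus\mu a$ if $\lambda+\mu\le1$, $\lambda(a\oplus b)=\lambda a\oplus\lambda b$ and $1a=a$. It is *strongly archimedean* if $a\le b\oplus\frac1n c$ for all $n\ge1$ (all these sums being defined) implies $a\le b$. An *order unit space* $(V,V^+,u)$ is an archimedean partially ordered real vector space with an order unit $u$; its unit interval $V[0,u]$ is a convex effect algebra. A *compression* on $(V,V^+,u)$ is a positive linear map $J:V\to V$ with $J(u)\le u$ such that for $a\in[0,u]$: $a\le J(u)$ implies $J(a)=a$, and $J(a)=0\iff a\le u-J(u)$. A *compression base* on $(V,V^+,u)$ is a family $(J_p)_{p\in P}$ of compressions on $V$ indexed by a sub-effect algebra $P\subseteq V[0,u]$ with $J_p(u)=p$ and such that for all $p,q\in P$ Mackey compatible in $V[0,u]$ there is $r\in P$ with $J_pJ_q=J_r$.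 With $C(p)=\{g\in V: g=J_p(g)+J_{u-p}(g)\}$ and $PC$, $P(g)$ defined as above, $V$ is *spectral* (Foulis–Pulmannová) with respect to $(J_p)_{p\in P}$ if * (general comparability) for each $g\in V$ there is $p\in P(g)$ with $J_{u-p}(g)\le0\le J_p(g)$; * (Rickart property) there is a map $*:V\to P$ such that for all $g\in V$, $p\in P$: $p\le g^*\iff g\in C(p)$ and $J_p(g)=0$. **Theorem.** Let $E$ be a convex and strongly archimedean effect algebra. Then $E$ is affinely isomorphic to the unit interval of an order unit space. Moreover, let $(V,V^+,u)$ be any order unit space with an affine isomorphism $E\simeq V[0,u]$. Then: 1. Every compression on $E$ extends to a unique compression on $(V,V^+,u)$, and every compression on $(V,V^+,u)$ is the extension of a unique compression on $E$. Likewise, every compression base $(J_p)_{p\in P}$ on $E$ extends to a unique compression base on $(V,V^+,u)$ with the same (corresponding) set of projections, and every compression base on $(V,V^+,u)$ is the extension of a unique compression base on $E$. 2. $E$ is spectral with respect to a compression base if and only if $(V,V^+,u)$ is spectral with respect to the corresponding compression base. In particular, there is a compression base with respect to which $E$ is spectral if and only if there is one with respect to which $(V,V^+,u)$ is spectral. 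-/

import Mathlib

universe uE uV

/-- An effect algebra: a set with a partial operation `⊕` and constants `0`, `1`.
`osum a b = some c` means that `a ⊕ b` is defined and equal to `c`, and
`osum a b = none` means that it is undefined. `compl a` is the unique `a'` with `a ⊕ a' = 1`. -/
class EffectAlgebra (E : Type*) where
  osum : E → E → Option E
  zero : E
  one : E
  compl : E → E
  osum_comm : ∀ a b c : E, osum a b = some c → osum b a = some c
  osum_assoc : ∀ a b c d e : E, osum a b = some d → osum d c = some e →
    ∃ f : E, osum b c = some f ∧ osum a f = some e
  osum_eq_one_iff : ∀ a b : E, osum a b = some one ↔ b = compl a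
  eq_zero_of_osum_one : ∀ a c : E, osum a one = some c → a = zero

namespace EffectAlgebra

section Basic

variable {E : Type*} [EffectAlgebra E]

/-- The order of an effect algebra: `a ≤ b` iff `a ⊕ c = b` for some `c`. -/
def Le (a b : E) : Prop := ∃ c : E, osum a c = some b

/-- Mackey compatibility: `a = a₁ ⊕ c` and `b = b₁ ⊕ c` for some `a₁, b₁, c` such that
`a₁ ⊕ b₁ ⊕ c` is defined. -/
def MackeyCompatible (a b : E) : Prop :=
  ∃ a₁ b₁ c s t : E, osum a₁ c = some a ∧ osum b₁ c = some b ∧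
    osum a₁ b₁ = some s ∧ osum s c = some t

/-- A sub-effect algebra. -/
structure IsSubEffectAlgebra (P : Set E) : Prop where
  zero_mem : zero ∈ P
  one_mem : one ∈ P
  compl_mem : ∀ a ∈ P, compl a ∈ P
  osum_mem : ∀ a ∈ P, ∀ b ∈ P, ∀ c : E, osum a b = some c → c ∈ P

/-- A Boolean subalgebra: a sub-effect algebra that is a Boolean algebra in the order and
with the orthosupplement inherited from `E`. -/
def IsBooleanSubalgebra (B : Set E) : Prop :=
  IsSubEffectAlgebra B ∧
    ∃ _ : BooleanAlgebra B,
      (∀ x y : B, x ≤ y ↔ Le (x : E) (y : E)) ∧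
      (∀ x : B, ((xᶜ : B) : E) = compl (x : E))

/-- Additive maps between effect algebras (here, self-maps). -/
def IsAdditive (J : E → E) : Prop :=
  ∀ a b c : E, osum a b = some c → osum (J a) (J b) = some (J c)

/-- A retraction: an additive map `J` with `J a = a` whenever `a ≤ J 1`. -/
def IsRetraction (J : E → E) : Prop :=
  IsAdditive J ∧ ∀ a : E, Le a (J one) → J a = a

/-- A compression: a retraction `J` with `J a = 0 ↔ a ≤ (J 1)'`. -/
def IsCompression (J : E → E) : Prop :=
  IsRetraction J ∧ ∀ a : E, J a = zero ↔ Le a (compl (J one))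

variable (E) in
/-- A compression base: a family `(J p)` of compressions indexed by a sub-effect algebra `P`. -/
structure CompressionBase where
  P : Set E
  isSubEffectAlgebra : IsSubEffectAlgebra P
  J : P → E → E
  isCompression : ∀ p : P, IsCompression (J p)
  focus : ∀ p : P, J p one = p
  comp : ∀ p q : P, MackeyCompatible (p : E) (q : E) → ∃ r : P, J p ∘ J q = J r

namespace CompressionBase

variable (b : CompressionBase E)

/-- The projection `p'`, for a projection `p`. -/
def perp (p : b.P) : b.P := ⟨compl (p : E), b.isSubEffectAlgebra.compl_mem p p.2⟩

/-- The commutant `C(p)` of a projection: all `a` with `a = J_p a ⊕ J_{p'} a`. -/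
def C (p : b.P) : Set E := {a | osum (b.J p a) (b.J (b.perp p) a) = some a}

/-- `PC(A)`: the projections `p` with `A ⊆ C(p)`. -/
def PC (A : Set E) : Set E := {p | ∃ hp : p ∈ b.P, ∀ a ∈ A, a ∈ b.C ⟨p, hp⟩}

/-- The bicommutant `P(Q) = PC(PC(Q) ∪ Q)`; `P(a)` is `P({a})` and `P(e, f)` is `P({e, f})`. -/
def bicommutant (Q : Set E) : Set E := b.PC (b.PC Q ∪ Q)

/-- The b-property of an element. -/
def IsBElement (a : E) : Prop :=
  ∃ B : Set E, B ⊆ b.P ∧ IsBooleanSubalgebra B ∧ ∀ p : b.P, a ∈ b.C p ↔ B ⊆ b.C p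

/-- The relation `e C f`: every element of `P(e)` is Mackey compatible with every
element of `P(f)`. -/
def Commutes (e f : E) : Prop :=
  ∀ p ∈ b.bicommutant {e}, ∀ q ∈ b.bicommutant {f}, MackeyCompatible p q

/-- The b-comparability property. -/
def BComparability : Prop :=
  (∀ a : E, b.IsBElement a) ∧
  ∀ e f : E, b.Commutes e f →
    ∃ p : b.P, (p : E) ∈ b.bicommutant {e, f} ∧
      Le (b.J p e) (b.J p f) ∧ Le (b.J (b.perp p) f) (b.J (b.perp p) e)

/-- The projection cover property. -/
def ProjectionCover : Prop :=
  ∀ a : E, ∃ p : b.P, ∀ q : b.P, Le a (q : E) ↔ Le (p : E) (q : E)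

/-- `E` is spectral with respect to the given compression base. -/
def IsSpectral : Prop := b.BComparability ∧ b.ProjectionCover

end CompressionBase

end Basic

end EffectAlgebra

open EffectAlgebra in
/-- A convex structure on an effect algebra: a multiplication by scalars of `[0, 1] ⊆ ℝ`. -/
class ConvexEffectAlgebra (E : Type*) [EffectAlgebra E] where
  scale : unitInterval → E → E
  scale_scale : ∀ (l m : unitInterval) (a : E), scale m (scale l a) = scale (l * m) a
  add_scale : ∀ (l m k : unitInterval) (a : E), (l : ℝ) + (m : ℝ) = (k : ℝ) →
    osum (scale l a) (scale m a) = some (scale k a)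
  scale_osum : ∀ (l : unitInterval) (a b c : E), osum a b = some c →
    osum (scale l a) (scale l b) = some (scale l c)
  one_scale : ∀ a : E, scale 1 a = a

namespace ConvexEffectAlgebra

open EffectAlgebra

/-- The scalar `1 / (n + 1)` of the unit interval. -/
noncomputable def recip (n : ℕ) : unitInterval :=
  ⟨1 / ((n : ℝ) + 1), by positivity, by
    rw [div_le_one (by positivity)]
    linarith [(Nat.cast_nonneg n : (0 : ℝ) ≤ n)]⟩

/-- Strongly archimedean: if `a ≤ b ⊕ (1/n) c` for all `n ≥ 1`, then `a ≤ b`. -/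
def StronglyArchimedean (E : Type*) [EffectAlgebra E] [ConvexEffectAlgebra E] : Prop :=
  ∀ a b c : E,
    (∀ n : ℕ, ∃ s : E, osum b (scale (recip n) c) = some s ∧ Le a s) → Le a b

end ConvexEffectAlgebra

namespace OrderUnit

section Space

variable {V : Type*} [AddCommGroup V] [PartialOrder V]

/-- `V` (with its cone of positive elements) is an order unit space with order unit `u`: the
element `u` is an order unit and `V` is archimedean. -/
structure IsOrderUnitSpace (u : V) : Prop where
  nonneg : 0 ≤ u
  exists_le : ∀ v : V, ∃ n : ℕ, v ≤ n • u
  archimedean : ∀ v w : V, (∀ n : ℕ, n • v ≤ w) → v ≤ 0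

/-- Mackey compatibility in the unit interval `[0, u]`. -/
def MackeyCompatible (u a b : V) : Prop :=
  ∃ a₁ b₁ c : V, 0 ≤ a₁ ∧ 0 ≤ b₁ ∧ 0 ≤ c ∧ a₁ + b₁ + c ≤ u ∧ a = a₁ + c ∧ b = b₁ + c

/-- A sub-effect algebra of the unit interval `[0, u]`. -/
structure IsSubEffectAlgebra (u : V) (P : Set V) : Prop where
  subset : P ⊆ Set.Icc 0 u
  zero_mem : 0 ∈ P
  unit_mem : u ∈ P
  compl_mem : ∀ a ∈ P, u - a ∈ P
  add_mem : ∀ a ∈ P, ∀ b ∈ P, a + b ≤ u → a + b ∈ P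

variable [Module ℝ V]

/-- A compression on `(V, V⁺, u)`: a positive linear map `J` with `J u ≤ u` such that, for all
`a ∈ [0, u]`, `a ≤ J u` implies `J a = a`, and `J a = 0` iff `a ≤ u - J u`. -/
structure IsCompression (u : V) (J : V →ₗ[ℝ] V) : Prop where
  positive : ∀ v : V, 0 ≤ v → 0 ≤ J v
  le_unit : J u ≤ u
  retract : ∀ a ∈ Set.Icc (0 : V) u, a ≤ J u → J a = a
  ker_iff : ∀ a ∈ Set.Icc (0 : V) u, J a = 0 ↔ a ≤ u - J u

/-- A compression base on `(V, V⁺, u)`. -/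
structure CompressionBase (u : V) where
  P : Set V
  isSubEffectAlgebra : IsSubEffectAlgebra u P
  J : P → V →ₗ[ℝ] V
  isCompression : ∀ p : P, IsCompression u (J p)
  focus : ∀ p : P, J p u = p
  comp : ∀ p q : P, MackeyCompatible u (p : V) (q : V) → ∃ r : P, J p ∘ₗ J q = J r

namespace CompressionBase

variable {u : V} (b : CompressionBase u)

/-- The projection `p' = u - p`, for a projection `p`. -/
def perp (p : b.P) : b.P := ⟨u - (p : V), b.isSubEffectAlgebra.compl_mem p p.2⟩

/-- The commutant `C(p)` of a projection in `V`: all `g` with `g = J_p g + J_{p'} g`. -/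
def C (p : b.P) : Set V := {g | g = b.J p g + b.J (b.perp p) g}

/-- `PC(A)`: the projections `p` with `A ⊆ C(p)`. -/
def PC (A : Set V) : Set V := {p | ∃ hp : p ∈ b.P, ∀ g ∈ A, g ∈ b.C ⟨p, hp⟩}

/-- The bicommutant `P(Q) = PC(PC(Q) ∪ Q)`; `P(g)` is `P({g})`. -/
def bicommutant (Q : Set V) : Set V := b.PC (b.PC Q ∪ Q)

/-- General comparability: for every `g` there is `p ∈ P(g)` with `J_{p'} g ≤ 0 ≤ J_p g`. -/
def GeneralComparability : Prop :=
  ∀ g : V, ∃ p : b.P, (p : V) ∈ b.bicommutant {g} ∧ b.J (b.perp p) g ≤ 0 ∧ 0 ≤ b.J p g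

/-- The Rickart property: there is a map `* : V → P` such that `p ≤ g*` iff `g ∈ C(p)` and
`J_p g = 0`. -/
def Rickart : Prop :=
  ∃ star : V → b.P, ∀ (g : V) (p : b.P),
    (p : V) ≤ (star g : V) ↔ g ∈ b.C p ∧ b.J p g = 0

/-- `(V, V⁺, u)` is spectral with respect to the given compression base. -/
def IsSpectral : Prop := b.GeneralComparability ∧ b.Rickart

end CompressionBase

end Space

end OrderUnit

open EffectAlgebra ConvexEffectAlgebra in
/-- An affine isomorphism of a convex effect algebra `E` onto the linear effect algebra
`V[0, u]`: a surjective morphism that reflects orthogonality and preserves convex structures. -/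
structure IntervalIso (E : Type*) [EffectAlgebra E] [ConvexEffectAlgebra E]
    (V : Type*) [AddCommGroup V] [PartialOrder V] [Module ℝ V] (u : V) where
  toFun : E → V
  mem_Icc : ∀ a : E, toFun a ∈ Set.Icc 0 u
  surj : ∀ v ∈ Set.Icc (0 : V) u, ∃ a : E, toFun a = v
  map_one : toFun one = u
  map_osum : ∀ a b c : E, osum a b = some c → toFun c = toFun a + toFun b
  reflects : ∀ a b : E, toFun a + toFun b ≤ u → ∃ c : E, osum a b = some c
  map_scale : ∀ (l : unitInterval) (a : E), toFun (scale l a) = (l : ℝ) • toFun a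

namespace IntervalIso

variable {E : Type*} [EffectAlgebra E] [ConvexEffectAlgebra E]
  {V : Type*} [AddCommGroup V] [PartialOrder V] [Module ℝ V] {u : V}

/-- The linear map `L` on `V` extends the map `J` on `E ≃ V[0, u]`. -/
def Extends (φ : IntervalIso E V u) (J : E → E) (L : V →ₗ[ℝ] V) : Prop :=
  ∀ a : E, L (φ.toFun a) = φ.toFun (J a)

/-- The compression base `c` on `V` extends the compression base `b` on `E ≃ V[0, u]`: they
have the same projections, and corresponding compressions extend one another. -/
def ExtendsBase (φ : IntervalIso E V u) (b : EffectAlgebra.CompressionBase E)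
    (c : OrderUnit.CompressionBase u) : Prop :=
  c.P = φ.toFun '' b.P ∧
    ∀ (p : b.P) (q : c.P), (q : V) = φ.toFun p → φ.Extends (b.J p) (c.J q)

end IntervalIso

/-! Existence of the space. A formal multiple `r a` is recorded by the germ at `0⁺` of its ray `t ↦
(t r) a`. For small `t` all sums are defined, so these germs form a cone with total addition, which
inherits associativity and cancellation from `⊕`. The differences of cone elements form an ordered
real vector space. Repeated halving (`osum_of_half_pow`, `exists_half_pow_eq`) carries information
at scale `2⁻ⁿ` back to scale `1`, so `E` is the whole interval below the image of `1`. Strong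
archimedeanity, after division by a common scalar, makes the space archimedean.

Compressions. A positive additive map on `[0, u]` is homogeneous by an archimedean squeeze
(`map_smul_of_additive`) and so extends to a linear map; the extension is unique because `[0, u]`
spans `V`. The compression axioms concern only `[0, u]`, apart from positivity, which scales. Hence
compressions, and then compression bases, correspond.

Spectrality. Commutants and bicommutants of elements of `E` are the same in `E` and in `V`. From `E`
to `V`: an element `g` is rescaled to `e ∈ [0, u]` with `e - u/2` a positive multiple of `g`. Since
`u/2` commutes with every projection, comparing `e` with `u/2` gives general comparability; then
`g*` is the complement of the cover of a multiple of `|g| = J_p g - J_{p'} g`. From `V` to `E`: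
binary expansion (`GeneralComparability.exists_approx`) approximates `g ≥ 0` by combinations of
projections in `P(g)`, so `g` commutes with a projection as soon as `P(g)` does. As `P(g)` is
Boolean, this is the b-property. Comparability of `e` and `f` comes from general comparability of `e
- f`, and the cover of `a` is the complement of `a*`. -/

set_option linter.unusedSectionVars false

/-! ### Partial addition and order in an effect algebra. -/

namespace EffectAlgebra

variable {E : Type*} [EffectAlgebra E]

theorem osum_compl (a : E) : osum a (compl a) = some one := (osum_eq_one_iff _ _).2 rfl

theorem osum_assoc_symm {a b c f e : E} (h₁ : osum b c = some f) (h₂ : osum a f = some e) :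
    ∃ d, osum a b = some d ∧ osum d c = some e := by
  obtain ⟨d, hd, hd'⟩ := osum_assoc _ _ _ _ _ (osum_comm _ _ _ h₁) (osum_comm _ _ _ h₂)
  exact ⟨d, osum_comm _ _ _ hd, osum_comm _ _ _ hd'⟩

theorem compl_compl (a : E) : compl (compl a) = a :=
  ((osum_eq_one_iff _ _).1 (osum_comm _ _ _ (osum_compl a))).symm

theorem compl_one : compl (one : E) = zero :=
  eq_zero_of_osum_one _ _ (osum_comm _ _ _ (osum_compl one))

theorem compl_zero : compl (zero : E) = one := by rw [← compl_one, compl_compl]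

theorem osum_zero (a : E) : osum a zero = some a := by
  have h₁ : osum (one : E) zero = some one := by rw [← compl_one]; exact osum_compl _
  obtain ⟨f, hf, hf'⟩ := osum_assoc _ _ _ _ _ (osum_comm _ _ _ (osum_compl a)) h₁
  rw [hf, (osum_eq_one_iff _ _).1 hf', compl_compl]

theorem zero_osum (a : E) : osum zero a = some a := osum_comm _ _ _ (osum_zero a)

/-- Completing `a ⊕ x = d` by `d'` to a sum equal to `1` exhibits `x` as the complement of `d' ⊕ a`,
which does not involve `x`. -/
theorem osum_left_cancel {a b c d : E} (h₁ : osum a b = some d) (h₂ : osum a c = some d) :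
    b = c := by
  have key : ∀ x, osum a x = some d →
      ∃ e, osum (compl d) a = some e ∧ x = compl e := by
    intro x hx
    obtain ⟨e, he, he'⟩ := osum_assoc_symm hx (osum_comm _ _ _ (osum_compl d))
    exact ⟨e, he, (osum_eq_one_iff _ _).1 he'⟩
  obtain ⟨e, he, rfl⟩ := key b h₁
  obtain ⟨e', he', rfl⟩ := key c h₂
  rw [he] at he'
  rw [Option.some.inj he']

theorem eq_zero_of_osum_eq_zero {a b : E} (h : osum a b = some zero) : b = zero := by
  obtain ⟨f, hf, -⟩ := osum_assoc _ _ _ _ _ h (zero_osum one)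
  exact eq_zero_of_osum_one _ _ hf

theorem Le.trans {a b c : E} (h₁ : Le a b) (h₂ : Le b c) : Le a c := by
  obtain ⟨x, hx⟩ := h₁
  obtain ⟨y, hy⟩ := h₂
  obtain ⟨f, -, hf⟩ := osum_assoc _ _ _ _ _ hx hy
  exact ⟨f, hf⟩

theorem le_one (a : E) : Le a one := ⟨_, osum_compl a⟩

theorem exists_osum_of_le_left {a b c d : E} (h : Le a b) (h' : osum b c = some d) :
    ∃ e, osum a c = some e ∧ Le e d := by
  obtain ⟨x, hx⟩ := h
  obtain ⟨f, hf, hf'⟩ := osum_assoc _ _ _ _ _ (osum_comm _ _ _ hx) h'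
  exact ⟨f, hf, x, osum_comm _ _ _ hf'⟩

theorem exists_osum_of_le {a b c d e : E} (h : Le a b) (h' : Le c d) (hs : osum b d = some e) :
    ∃ f, osum a c = some f ∧ Le f e := by
  obtain ⟨x, hx, hxe⟩ := exists_osum_of_le_left h hs
  obtain ⟨y, hy, hyx⟩ := exists_osum_of_le_left h' (osum_comm _ _ _ hx)
  exact ⟨y, osum_comm _ _ _ hy, hyx.trans hxe⟩

/-- Interchange of the middle summands in `(a ⊕ b) ⊕ (c ⊕ d)`. -/
theorem osum_osum_osum_comm {a b c d x y e : E} (h₁ : osum a b = some x) (h₂ : osum c d = some y)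
    (h : osum x y = some e) :
    ∃ p q, osum a c = some p ∧ osum b d = some q ∧ osum p q = some e := by
  obtain ⟨f, hf, hf'⟩ := osum_assoc _ _ _ _ _ h₁ h
  obtain ⟨g, hg, hg'⟩ := osum_assoc_symm h₂ hf
  obtain ⟨q, hq, hq'⟩ := osum_assoc _ _ _ _ _ (osum_comm _ _ _ hg) hg'
  obtain ⟨p, hp, hp'⟩ := osum_assoc_symm hq' hf'
  exact ⟨p, q, hp, hq, hp'⟩

end EffectAlgebra

/-! ### Scalar multiplication and halving in a convex effect algebra. -/

namespace ConvexEffectAlgebra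

open EffectAlgebra

variable {E : Type*} [EffectAlgebra E] [ConvexEffectAlgebra E]

/-- Multiplication by a real number, clipped to the unit interval. -/
noncomputable def rscale (t : ℝ) (a : E) : E := scale (Set.projIcc 0 1 zero_le_one t) a

theorem rscale_coe (t : unitInterval) (a : E) : rscale t a = scale t a := by
  rw [rscale, Set.projIcc_val]

theorem rscale_rscale {s t : ℝ} (hs : 0 ≤ s) (hs' : s ≤ 1) (ht : 0 ≤ t) (ht' : t ≤ 1) (a : E) :
    rscale s (rscale t a) = rscale (s * t) a := by
  lift s to unitInterval using ⟨hs, hs'⟩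
  lift t to unitInterval using ⟨ht, ht'⟩
  rw [rscale_coe, rscale_coe, scale_scale, ← rscale_coe, mul_comm]
  rfl

theorem osum_rscale {s t : ℝ} (hs : 0 ≤ s) (ht : 0 ≤ t) (h : s + t ≤ 1) (a : E) :
    osum (rscale s a) (rscale t a) = some (rscale (s + t) a) := by
  have := add_scale ⟨s, hs, by linarith⟩ ⟨t, ht, by linarith⟩ ⟨s + t, by linarith, h⟩ a rfl
  simpa only [← rscale_coe] using this

theorem rscale_osum {a b c : E} (h : osum a b = some c) (t : ℝ) :
    osum (rscale t a) (rscale t b) = some (rscale t c) := scale_osum _ _ _ _ h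

theorem rscale_one (a : E) : rscale 1 a = a := by
  have := rscale_coe 1 a
  rw [one_scale] at this
  exact this

theorem rscale_zero (a : E) : rscale 0 a = zero := by
  have h := osum_rscale le_rfl le_rfl (by norm_num) a
  rw [add_zero] at h
  exact osum_left_cancel h (osum_zero _)

theorem rscale_zero_right (t : ℝ) : rscale t (zero : E) = zero :=
  osum_left_cancel (rscale_osum (osum_zero zero) t) (osum_zero _)

theorem rscale_le {t : ℝ} {a b : E} (h : Le a b) : Le (rscale t a) (rscale t b) := by
  obtain ⟨c, hc⟩ := h
  exact ⟨_, rscale_osum hc t⟩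

theorem exists_osum_rscale {s t : ℝ} (hs : 0 ≤ s) (ht : 0 ≤ t) (h : s + t ≤ 1) (a b : E) :
    ∃ c, osum (rscale s a) (rscale t b) = some c := by
  obtain ⟨c, hc, -⟩ := exists_osum_of_le (rscale_le (le_one a)) (rscale_le (le_one b))
    (osum_rscale hs ht h one)
  exact ⟨c, hc⟩

theorem osum_half (a : E) : osum (rscale (1 / 2) a) (rscale (1 / 2) a) = some a := by
  have := osum_rscale (s := 1 / 2) (t := 1 / 2) (by norm_num) (by norm_num) (by norm_num) a
  rwa [add_halves, rscale_one] at this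

/-- If `a/2 ⊕ d = b/2`, adding the equation to itself and interchanging the middle terms gives `a ⊕
(d ⊕ d) = b`. -/
theorem le_of_half_le {a b : E} (h : Le (rscale (1 / 2) a) (rscale (1 / 2) b)) : Le a b := by
  obtain ⟨d, hd⟩ := h
  obtain ⟨p, q, hp, -, hpq⟩ := osum_osum_osum_comm hd hd (osum_half b)
  rw [osum_half] at hp
  exact ⟨q, by rw [Option.some.inj hp, hpq]⟩

theorem osum_of_half {a b c : E}
    (h : osum (rscale (1 / 2) a) (rscale (1 / 2) b) = some (rscale (1 / 2) c)) :
    osum a b = some c := by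
  obtain ⟨p, q, hp, hq, hpq⟩ := osum_osum_osum_comm h h (osum_half c)
  rw [osum_half] at hp hq
  rwa [Option.some.inj hp, Option.some.inj hq]

/-- Below `1/2` the sum `a ⊕ a` is defined, and its half is `a/2 ⊕ a/2 = a`. -/
theorem exists_half_eq {a : E} (h : Le a (rscale (1 / 2) one)) : ∃ c, rscale (1 / 2) c = a := by
  obtain ⟨c, hc, -⟩ := exists_osum_of_le h h (osum_half one)
  exact ⟨c, Option.some.inj ((rscale_osum hc _ ▸ osum_half a : some _ = some a))⟩

theorem half_pow_nonneg (n : ℕ) : (0 : ℝ) ≤ (1 / 2) ^ n := by positivity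

theorem half_pow_le_one (n : ℕ) : (1 / 2 : ℝ) ^ n ≤ 1 := pow_le_one₀ (by norm_num) (by norm_num)

theorem rscale_half_pow_succ (n : ℕ) (a : E) :
    rscale ((1 / 2) ^ (n + 1)) a = rscale (1 / 2) (rscale ((1 / 2) ^ n) a) := by
  rw [rscale_rscale (by norm_num) (by norm_num) (half_pow_nonneg n) (half_pow_le_one n), pow_succ']

theorem osum_of_half_pow (n : ℕ) {a b c : E}
    (h : osum (rscale ((1 / 2) ^ n) a) (rscale ((1 / 2) ^ n) b) = some (rscale ((1 / 2) ^ n) c)) :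
    osum a b = some c := by
  induction n with
  | zero => simpa only [pow_zero, rscale_one] using h
  | succ n ih =>
    simp only [rscale_half_pow_succ] at h
    exact ih (osum_of_half h)

theorem exists_half_pow_eq (n : ℕ) {a : E} (h : Le a (rscale ((1 / 2) ^ n) one)) :
    ∃ c, rscale ((1 / 2) ^ n) c = a := by
  induction n generalizing a with
  | zero => exact ⟨a, by rw [pow_zero, rscale_one]⟩
  | succ n ih =>
    rw [rscale_half_pow_succ] at h
    obtain ⟨c, rfl⟩ := exists_half_eq (h.trans (rscale_le (le_one _)))
    obtain ⟨d, rfl⟩ := ih (le_of_half_le h)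
    exact ⟨d, rscale_half_pow_succ n d⟩

end ConvexEffectAlgebra

/-! ### The cone of formal multiples, as germs of rays at zero. -/

namespace ConvexEffectAlgebra

open EffectAlgebra Filter Topology
open scoped NNReal

variable {E : Type*} [EffectAlgebra E] [ConvexEffectAlgebra E]

/-- The map `t ↦ t (r a)`, which is meaningful for `0 ≤ t` with `t r ≤ 1`. -/
noncomputable def ray (x : ℝ≥0 × E) (t : ℝ) : E := rscale (t * x.1) x.2

variable (E) in
/-- The cone spanned by a convex effect algebra: formal multiples `r a`, identified when the
rays `t ↦ t (r a)` agree near zero. -/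
def Cone : Type _ := Quotient (Setoid.ker fun x : ℝ≥0 × E => (ray x : Germ (𝓝[>] (0 : ℝ)) E))

theorem eventually_nhdsGT_mul {r : ℝ} (hr : 0 < r) {p : ℝ → Prop} (h : ∀ᶠ t in 𝓝[>] 0, p t) :
    ∀ᶠ t in 𝓝[>] 0, p (r * t) := by
  refine Tendsto.eventually (tendsto_nhdsWithin_iff.2 ⟨?_, ?_⟩) h
  · have : Tendsto (fun t : ℝ => r * t) (𝓝 0) (𝓝 (r * 0)) := (continuous_const_mul r).tendsto 0
    rw [mul_zero] at this
    exact this.mono_left nhdsWithin_le_nhds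
  · filter_upwards [self_mem_nhdsWithin] with t ht using mul_pos hr ht

theorem eventually_nhdsGT_mul_le_one (r : ℝ) : ∀ᶠ t : ℝ in 𝓝[>] 0, 0 < t ∧ t * r ≤ 1 := by
  have h : ∀ᶠ t : ℝ in 𝓝 0, t * r < 1 := by
    refine (continuous_mul_const r).tendsto 0 |>.eventually_lt_const ?_
    simp
  filter_upwards [self_mem_nhdsWithin, nhdsWithin_le_nhds h] with t ht ht' using ⟨ht, ht'.le⟩

/-- A property of small scales holds at some dyadic scale, where the halving lemmas can undo the
scaling. -/
theorem exists_half_pow_of_eventually {p : ℝ → Prop} (h : ∀ᶠ t in 𝓝[>] 0, p t) :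
    ∃ n : ℕ, p ((1 / 2) ^ n) :=
  ((tendsto_pow_atTop_nhdsWithin_zero_of_lt_one (by norm_num) (by norm_num)).eventually h).exists

namespace Cone

/-- The class of `r a` in the cone. -/
noncomputable def mk (r : ℝ≥0) (a : E) : Cone E := Quotient.mk _ (r, a)

/-- The ray of an element of the cone. -/
noncomputable def eval (x : Cone E) : ℝ → E := ray (Quotient.out x)

theorem eval_mk (r : ℝ≥0) (a : E) : ∀ᶠ t in 𝓝[>] 0, eval (mk r a) t = rscale (t * r) a :=
  Germ.coe_eq.1 (Quotient.mk_out
    (s := Setoid.ker fun x : ℝ≥0 × E => (ray x : Germ (𝓝[>] (0 : ℝ)) E)) (r, a))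

theorem exists_eq_mk (x : Cone E) : ∃ r a, x = mk r a :=
  ⟨(Quotient.out x).1, (Quotient.out x).2, (Quotient.out_eq x).symm⟩

theorem ext_eval {x y : Cone E} (h : ∀ᶠ t in 𝓝[>] 0, eval x t = eval y t) : x = y := by
  rw [← Quotient.out_eq x, ← Quotient.out_eq y]
  exact Quotient.sound (Germ.coe_eq.2 h)

theorem exists_osum (x y : Cone E) :
    ∃ z : Cone E, ∀ᶠ t in 𝓝[>] 0, osum (eval x t) (eval y t) = some (eval z t) := by
  obtain ⟨r, a, rfl⟩ := exists_eq_mk x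
  obtain ⟨s, b, rfl⟩ := exists_eq_mk y
  -- Dividing by `r + s + 1` makes both weights and their sum at most `1`; the extra `1` keeps the
  -- divisor positive when `r = s = 0`.
  have hT : (0 : ℝ) < r + s + 1 := by positivity
  obtain ⟨c, hc⟩ := exists_osum_rscale (s := r / (r + s + 1)) (t := s / (r + s + 1))
    (by positivity) (by positivity) (by rw [← add_div, div_le_one hT]; linarith) a b
  refine ⟨mk (r + s + 1) c, ?_⟩
  filter_upwards [eval_mk r a, eval_mk s b, eval_mk (r + s + 1) c,
    eventually_nhdsGT_mul_le_one (r + s + 1)] with t h₁ h₂ h₃ ⟨ht, ht'⟩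
  have key := rscale_osum hc (t * (r + s + 1))
  rw [rscale_rscale (by positivity) ht' (by positivity)
      (by rw [div_le_one hT]; linarith [s.coe_nonneg]),
    rscale_rscale (by positivity) ht' (by positivity)
      (by rw [div_le_one hT]; linarith [r.coe_nonneg]),
    mul_assoc, mul_div_cancel₀ _ hT.ne', mul_assoc, mul_div_cancel₀ _ hT.ne'] at key
  rw [h₁, h₂, h₃, key]
  push_cast
  rfl

noncomputable instance : Add (Cone E) := ⟨fun x y => (exists_osum x y).choose⟩

theorem eval_add (x y : Cone E) :
    ∀ᶠ t in 𝓝[>] 0, osum (eval x t) (eval y t) = some (eval (x + y) t) :=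
  (exists_osum x y).choose_spec

theorem add_eq_of_eventually {x y z : Cone E}
    (h : ∀ᶠ t in 𝓝[>] 0, osum (eval x t) (eval y t) = some (eval z t)) : x + y = z := by
  refine ext_eval ?_
  filter_upwards [h, eval_add x y] with t h₁ h₂
  exact Option.some.inj (h₂.symm.trans h₁)

noncomputable instance : Zero (Cone E) := ⟨mk 0 zero⟩

theorem eval_zero : ∀ᶠ t in 𝓝[>] 0, eval (0 : Cone E) t = zero := by
  filter_upwards [eval_mk 0 (zero : E)] with t ht
  exact ht.trans (rscale_zero_right _)

/-- Defined through a chosen representative; `smul_mk` shows that the choice is immaterial. -/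
noncomputable instance : SMul ℝ≥0 (Cone E) :=
  ⟨fun r x => mk (r * (Quotient.out x).1) (Quotient.out x).2⟩

theorem eval_smul (r : ℝ≥0) (x : Cone E) : ∀ᶠ t in 𝓝[>] 0, eval (r • x) t = eval x (r * t) := by
  filter_upwards [eval_mk (r * (Quotient.out x).1) (Quotient.out x).2] with t ht
  refine ht.trans ?_
  rw [eval, ray]
  push_cast
  rw [← mul_assoc, mul_comm t]

theorem smul_mk (r s : ℝ≥0) (a : E) : r • mk s a = mk (r * s) a := by
  refine ext_eval ?_
  rcases eq_zero_or_pos r with rfl | hr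
  · filter_upwards [eval_smul 0 (mk s a), eval_mk (0 * s) a] with t h₁ h₂
    rw [h₁, h₂, eval, ray]
    simp [rscale_zero]
  -- The factor `0` is treated apart, since `t ↦ r t` preserves the punctured right neighbourhoods
  -- of `0` only for `r > 0`.
  · filter_upwards [eval_smul r (mk s a), eventually_nhdsGT_mul (NNReal.coe_pos.2 hr) (eval_mk s a),
      eval_mk (r * s) a] with t h₁ h₂ h₃
    rw [h₁, h₂, h₃]
    push_cast
    rw [← mul_assoc, mul_comm t]

theorem add_comm' (x y : Cone E) : x + y = y + x := by
  refine add_eq_of_eventually ?_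
  filter_upwards [eval_add y x] with t ht using osum_comm _ _ _ ht

theorem zero_add' (x : Cone E) : 0 + x = x := by
  refine add_eq_of_eventually ?_
  filter_upwards [eval_zero (E := E)] with t ht
  rw [ht, zero_osum]

theorem zero_smul' (x : Cone E) : (0 : ℝ≥0) • x = 0 := by
  refine ext_eval ?_
  filter_upwards [eval_smul 0 x, eval_zero (E := E)] with t h₁ h₂
  rw [h₁, h₂, eval, ray]
  simp [rscale_zero]

noncomputable instance : AddCommMonoid (Cone E) where
  add_assoc x y z := by
    refine add_eq_of_eventually ?_
    filter_upwards [eval_add x y, eval_add y z, eval_add x (y + z)] with t h₁ h₂ h₃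
    obtain ⟨d, hd, hd'⟩ := osum_assoc_symm h₂ h₃
    rw [h₁] at hd
    rwa [Option.some.inj hd]
  zero_add := zero_add'
  add_zero x := by rw [add_comm', zero_add']
  add_comm := add_comm'
  nsmul := nsmulRec

noncomputable instance : Module ℝ≥0 (Cone E) where
  one_smul x := by
    obtain ⟨r, a, rfl⟩ := exists_eq_mk x
    rw [smul_mk, one_mul]
  mul_smul r s x := by
    obtain ⟨q, a, rfl⟩ := exists_eq_mk x
    rw [smul_mk, smul_mk, smul_mk, mul_assoc]
  smul_zero r := by
    change r • mk 0 zero = mk 0 zero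
    rw [smul_mk, mul_zero]
  smul_add r x y := by
    rcases eq_zero_or_pos r with rfl | hr
    · rw [zero_smul', zero_smul', zero_smul', zero_add']
    · refine (add_eq_of_eventually ?_).symm
      filter_upwards [eval_smul r x, eval_smul r y, eval_smul r (x + y),
        eventually_nhdsGT_mul (NNReal.coe_pos.2 hr) (eval_add x y)] with t h₁ h₂ h₃ h₄
      rw [h₁, h₂, h₃, h₄]
  add_smul r s x := by
    obtain ⟨q, a, rfl⟩ := exists_eq_mk x
    rw [smul_mk, smul_mk, smul_mk]
    refine (add_eq_of_eventually ?_).symm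
    filter_upwards [eval_mk ((r + s) * q) a, eval_mk (r * q) a, eval_mk (s * q) a,
      eventually_nhdsGT_mul_le_one ((r + s) * q)] with t h₁ h₂ h₃ ⟨ht, ht'⟩
    rw [h₁, h₂, h₃]
    push_cast
    rw [osum_rscale (by positivity) (by positivity) (by linarith)]
    ring_nf
  zero_smul := zero_smul'

instance : IsCancelAdd (Cone E) :=
  have : IsLeftCancelAdd (Cone E) := ⟨fun x y z h => by
    have h : x + y = x + z := h
    refine ext_eval ?_
    filter_upwards [eval_add x y, eval_add x z] with t h₁ h₂
    rw [h] at h₁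
    exact osum_left_cancel h₁ h₂⟩
  AddCommMagma.IsLeftCancelAdd.toIsCancelAdd _

theorem eq_zero_of_add_eq_zero {x y : Cone E} (h : x + y = 0) : y = 0 := by
  refine ext_eval ?_
  filter_upwards [eval_add x y, eval_zero (E := E)] with t h₁ h₂
  rw [h, h₂] at h₁
  rw [eq_zero_of_osum_eq_zero h₁, h₂]

/-- The embedding of a convex effect algebra into its cone. -/
noncomputable def of (a : E) : Cone E := mk 1 a

theorem eval_of (a : E) : ∀ᶠ t in 𝓝[>] 0, eval (of a) t = rscale t a := by
  filter_upwards [eval_mk 1 a] with t ht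
  rw [of, ht, NNReal.coe_one, mul_one]

theorem mk_eq_smul_of (r : ℝ≥0) (a : E) : mk r a = r • of a := by rw [of, smul_mk, mul_one]

theorem of_rscale (t : ℝ≥0) (ht : t ≤ 1) (a : E) : of (rscale t a) = t • of a := by
  rw [← mk_eq_smul_of]
  refine ext_eval ?_
  filter_upwards [eval_of (rscale t a), eval_mk t a, eventually_nhdsGT_mul_le_one 1]
    with s h₁ h₂ ⟨h₃, h₄⟩
  rw [h₁, h₂, rscale_rscale h₃.le (by linarith) t.coe_nonneg (by exact_mod_cast ht)]

/-- An equation in the cone holds in `E` at some scale `2⁻ⁿ`, and doubling `n` times removes the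
scale. This makes `E` embed with its partial sums intact. -/
theorem of_add_of {a b c : E} : of a + of b = of c ↔ osum a b = some c := by
  constructor
  · intro h
    obtain ⟨n, h₁, h₂, h₃, h₄⟩ := exists_half_pow_of_eventually
      ((eval_of a).and ((eval_of b).and ((eval_of c).and (eval_add (of a) (of b)))))
    refine osum_of_half_pow n ?_
    rw [← h₁, ← h₂, ← h₃, h₄, h]
  · intro h
    refine add_eq_of_eventually ?_
    filter_upwards [eval_of a, eval_of b, eval_of c] with t h₁ h₂ h₃
    rw [h₁, h₂, h₃, rscale_osum h]

/-- At some scale `2⁻ⁿ` the ray of `x` lies below `2⁻ⁿ 1`, hence equals `2⁻ⁿ c` for some `c` in `E`;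
rescaling shows that the rays of `x` and `c` agree near zero. -/
theorem exists_eq_of {x y : Cone E} (h : x + y = of one) : ∃ a, x = of a := by
  obtain ⟨r, b, rfl⟩ := exists_eq_mk x
  obtain ⟨n, h₁, h₂, h₃, -, h₄⟩ := exists_half_pow_of_eventually ((eval_add (mk r b) y).and
    ((eval_of (one : E)).and ((eval_mk r b).and (eventually_nhdsGT_mul_le_one r))))
  obtain ⟨c, hc⟩ := exists_half_pow_eq n (a := eval (mk r b) ((1 / 2) ^ n))
    ⟨eval y ((1 / 2) ^ n), by rw [h₁, h, h₂]⟩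
  refine ⟨c, ext_eval ?_⟩
  have hp : (0 : ℝ) < (1 / 2) ^ n := by positivity
  filter_upwards [eval_mk r b, eval_of c, eventually_nhdsGT_mul_le_one (((1 / 2) ^ n)⁻¹)]
    with t h₅ h₆ ⟨ht, ht'⟩
  have e : ∀ s : ℝ, t * ((1 / 2) ^ n)⁻¹ * ((1 / 2) ^ n * s) = t * s := fun s => by
    field_simp
  have key := congrArg (rscale (t * ((1 / 2) ^ n)⁻¹)) (hc.trans h₃)
  rw [rscale_rscale (by positivity) ht' hp.le (half_pow_le_one n),
    rscale_rscale (by positivity) ht' (by positivity) h₄, e] at key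
  rw [h₅, h₆, ← key, inv_mul_cancel_right₀ hp.ne']

theorem exists_eq_smul_of (x : Cone E) : ∃ r : ℝ≥0, ∃ a, x = r • of a := by
  obtain ⟨r, a, rfl⟩ := exists_eq_mk x
  exact ⟨r, a, mk_eq_smul_of r a⟩

end Cone

end ConvexEffectAlgebra

/-! ### From non-negative to real scalars. -/

open scoped NNReal

/-- The extension to `ℝ` of a homomorphism from the semiring `ℝ≥0` to a ring. -/
noncomputable def NNReal.extendToReal {R : Type*} [Ring R] (f : ℝ≥0 →+* R) : ℝ →+* R :=
  -- The value depends only on the difference `a - b`, so each ring law may be checked on a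
  -- convenient decomposition instead of on positive and negative parts.
  have key : ∀ (r : ℝ) (a b : ℝ≥0), r = a - b → f r.toNNReal - f (-r).toNNReal = f a - f b := by
    intro r a b h
    rw [sub_eq_sub_iff_add_eq_add, ← map_add, ← map_add]
    congr 1
    rw [← NNReal.coe_inj]
    push_cast
    rw [Real.coe_toNNReal', Real.coe_toNNReal']
    rcases le_total 0 r with hr | hr
    · rw [max_eq_left hr, max_eq_right (by linarith)]
      linarith
    · rw [max_eq_right hr, max_eq_left (by linarith)]
      linarith
  have rep : ∀ r : ℝ, r = r.toNNReal - (-r).toNNReal := fun r => by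
    rw [Real.coe_toNNReal', Real.coe_toNNReal', max_zero_sub_max_neg_zero_eq_self]
  { toFun r := f r.toNNReal - f (-r).toNNReal
    map_one' := by
      rw [key 1 1 0 (by simp), map_one, map_zero, sub_zero]
    map_mul' r s := by
      rw [key (r * s) (r.toNNReal * s.toNNReal + (-r).toNNReal * (-s).toNNReal)
        (r.toNNReal * (-s).toNNReal + (-r).toNNReal * s.toNNReal)]
      · simp only [map_add, map_mul]
        noncomm_ring
      · push_cast
        conv_lhs => rw [rep r, rep s]
        ring
    map_zero' := by
      rw [key 0 0 0 (by simp), map_zero, sub_zero]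
    map_add' r s := by
      rw [key (r + s) (r.toNNReal + s.toNNReal) ((-r).toNNReal + (-s).toNNReal)]
      · simp only [map_add]
        abel
      · push_cast
        conv_lhs => rw [rep r, rep s]
        ring }

theorem NNReal.extendToReal_coe {R : Type*} [Ring R] (f : ℝ≥0 →+* R) (r : ℝ≥0) :
    NNReal.extendToReal f r = f r := by
  change f (r : ℝ).toNNReal - f (-(r : ℝ)).toNNReal = f r
  rw [Real.toNNReal_coe, Real.toNNReal_of_nonpos (by simp), map_zero, sub_zero]

/-! ### The ordered vector space spanned by a convex effect algebra. -/

namespace ConvexEffectAlgebra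

open EffectAlgebra Algebra

variable {E : Type*} [EffectAlgebra E] [ConvexEffectAlgebra E]

variable (E) in
/-- The ordered vector space spanned by a convex effect algebra: the group of formal differences
of elements of its cone. -/
def Envelope : Type _ := GrothendieckAddGroup (Cone E)

namespace Envelope

noncomputable instance : AddCommGroup (Envelope E) :=
  inferInstanceAs (AddCommGroup (GrothendieckAddGroup (Cone E)))

/-- The embedding of the cone in the vector space it spans. -/
noncomputable def ofCone : Cone E →+ Envelope E := GrothendieckAddGroup.of

theorem ofCone_injective : Function.Injective (ofCone : Cone E → Envelope E) :=
  GrothendieckAddGroup.of_injective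

theorem exists_eq_sub (v : Envelope E) : ∃ x y, v = ofCone x - ofCone y := by
  induction v using AddLocalization.induction_on with
  | H z =>
    refine ⟨z.1, z.2, eq_sub_of_add_eq ?_⟩
    have : AddLocalization.mk z.1 z.2 + AddLocalization.mk (z.2 : Cone E) 0
        = AddLocalization.mk z.1 0 := by
      rw [AddLocalization.mk_add, AddLocalization.mk_eq_mk_iff']
      simp [add_comm]
    exact this

theorem hom_ext {f g : AddMonoid.End (Envelope E)} (h : ∀ x, f (ofCone x) = g (ofCone x)) :
    f = g := by
  refine AddMonoidHom.ext fun v => ?_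
  obtain ⟨x, y, rfl⟩ := exists_eq_sub v
  exact (map_sub f _ _).trans ((congrArg₂ _ (h x) (h y)).trans (map_sub g _ _).symm)

theorem exists_hom (f : Cone E →+ Cone E) :
    ∃ g : Envelope E →+ Envelope E, ∀ x, g (ofCone x) = ofCone (f x) := by
  refine ⟨GrothendieckAddGroup.lift (G := GrothendieckAddGroup (Cone E))
    ((GrothendieckAddGroup.of (M := Cone E)).comp f), fun x => ?_⟩
  exact DFunLike.congr_fun (GrothendieckAddGroup.lift.symm_apply_apply
    ((GrothendieckAddGroup.of (M := Cone E)).comp f)) x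

/-- The action of the non-negative reals. -/
noncomputable def nnsmul : ℝ≥0 →+* AddMonoid.End (Envelope E) :=
  have key : ∀ r : ℝ≥0, ∃ g : AddMonoid.End (Envelope E), ∀ x, g (ofCone x) = ofCone (r • x) :=
    fun r => exists_hom (DistribSMul.toAddMonoidHom (Cone E) r)
  have h : ∀ r x, (key r).choose (ofCone x) = ofCone (r • x) := fun r => (key r).choose_spec
  { toFun r := (key r).choose
    map_one' := hom_ext fun x => by rw [h, one_smul, AddMonoid.End.coe_one, _root_.id]
    map_mul' r s := hom_ext fun x => by
      change _ = (key r).choose ((key s).choose (ofCone x))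
      rw [h, h, h, mul_smul]
    map_zero' := hom_ext fun x => by rw [h, zero_smul, map_zero, AddMonoid.End.zero_apply]
    map_add' r s := hom_ext fun x => by
      change _ = (key r).choose (ofCone x) + (key s).choose (ofCone x)
      rw [h, h, h, add_smul, map_add] }

theorem nnsmul_ofCone (r : ℝ≥0) (x : Cone E) : nnsmul r (ofCone x) = ofCone (r • x) :=
  (exists_hom (DistribSMul.toAddMonoidHom (Cone E) r)).choose_spec x

noncomputable instance : Module ℝ (Envelope E) :=
  Module.compHom _ (NNReal.extendToReal (nnsmul (E := E)))

theorem coe_smul_ofCone (r : ℝ≥0) (x : Cone E) : (r : ℝ) • ofCone x = ofCone (r • x) := by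
  rw [← nnsmul_ofCone, ← NNReal.extendToReal_coe]
  rfl

/-- The order whose positive elements are the cone. Antisymmetry holds because the cone is
cancellative and contains no nonzero element together with its negative. -/
noncomputable instance : PartialOrder (Envelope E) where
  le v w := ∃ x, v + ofCone x = w
  le_refl v := ⟨0, by rw [map_zero, add_zero]⟩
  le_trans := by
    rintro v _ _ ⟨x, rfl⟩ ⟨y, rfl⟩
    exact ⟨x + y, by rw [map_add, add_assoc]⟩
  le_antisymm := by
    rintro v _ ⟨x, rfl⟩ ⟨y, h⟩
    rw [add_assoc, add_eq_left, ← map_add, ← map_zero ofCone] at h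
    have hx := Cone.eq_zero_of_add_eq_zero ((add_comm y x).trans (ofCone_injective h))
    rw [hx, map_zero, add_zero]

theorem le_iff {v w : Envelope E} : v ≤ w ↔ ∃ x, v + ofCone x = w := Iff.rfl

theorem nonneg_iff {v : Envelope E} : 0 ≤ v ↔ ∃ x, v = ofCone x := by
  simp only [le_iff, zero_add, eq_comm]

theorem ofCone_le_ofCone {x y : Cone E} : ofCone x ≤ ofCone y ↔ ∃ z, x + z = y := by
  simp only [le_iff, ← map_add, ofCone_injective.eq_iff]

instance : IsOrderedAddMonoid (Envelope E) where
  add_le_add_left := by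
    rintro v _ ⟨x, rfl⟩ w
    exact ⟨x, add_right_comm _ _ _⟩

instance : IsOrderedModule ℝ (Envelope E) :=
  IsOrderedModule.of_smul_nonneg fun r hr v hv => by
    obtain ⟨x, rfl⟩ := nonneg_iff.1 hv
    lift r to ℝ≥0 using hr
    exact nonneg_iff.2 ⟨_, coe_smul_ofCone r x⟩

/-- The embedding of a convex effect algebra into the vector space it spans. -/
noncomputable def of (a : E) : Envelope E := ofCone (Cone.of a)

theorem of_nonneg (a : E) : 0 ≤ of a := nonneg_iff.2 ⟨_, rfl⟩

theorem of_le_of {a b : E} : of a ≤ of b ↔ Le a b := by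
  rw [of, of, ofCone_le_ofCone]
  constructor
  · rintro ⟨z, hz⟩
    obtain ⟨c, rfl⟩ : ∃ c, z = Cone.of c := by
      -- The difference `z` lies in `E` because `z + (a + b') = b + b' = 1`.
      refine Cone.exists_eq_of (y := Cone.of a + Cone.of (compl b)) ?_
      rw [← add_assoc, add_comm z, hz, Cone.of_add_of]
      exact osum_compl b
    exact ⟨c, Cone.of_add_of.1 hz⟩
  · rintro ⟨c, hc⟩
    exact ⟨Cone.of c, Cone.of_add_of.2 hc⟩

theorem of_osum {a b c : E} (h : osum a b = some c) : of c = of a + of b := by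
  rw [of, of, of, ← map_add, Cone.of_add_of.2 h]

theorem exists_of_eq {v : Envelope E} (h₀ : 0 ≤ v) (h₁ : v ≤ of one) : ∃ a, of a = v := by
  obtain ⟨x, rfl⟩ := nonneg_iff.1 h₀
  obtain ⟨y, hy⟩ := ofCone_le_ofCone.1 h₁
  obtain ⟨a, rfl⟩ := Cone.exists_eq_of hy
  exact ⟨a, rfl⟩

theorem of_rscale {t : ℝ} (ht : 0 ≤ t) (ht' : t ≤ 1) (a : E) : of (rscale t a) = t • of a := by
  lift t to ℝ≥0 using ht
  rw [of, of, coe_smul_ofCone, Cone.of_rscale t (by exact_mod_cast ht')]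

theorem exists_osum_of_le {a b : E} (h : of a + of b ≤ of one) : ∃ c, osum a b = some c := by
  obtain ⟨c, hc⟩ := exists_of_eq (add_nonneg (of_nonneg a) (of_nonneg b)) h
  refine ⟨c, Cone.of_add_of.1 (ofCone_injective ?_)⟩
  rw [map_add]
  exact hc.symm

theorem exists_smul_of (v : Envelope E) (hv : 0 ≤ v) : ∃ r : ℝ, 0 ≤ r ∧ ∃ a, v = r • of a := by
  obtain ⟨x, rfl⟩ := nonneg_iff.1 hv
  obtain ⟨r, a, rfl⟩ := Cone.exists_eq_smul_of x
  exact ⟨r, r.coe_nonneg, a, (coe_smul_ofCone r _).symm⟩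

theorem exists_sub_of (v : Envelope E) :
    ∃ r s : ℝ, ∃ a b, 0 ≤ r ∧ 0 ≤ s ∧ v = r • of a - s • of b := by
  obtain ⟨x, y, rfl⟩ := exists_eq_sub v
  obtain ⟨r, hr, a, h⟩ := exists_smul_of _ (nonneg_iff.2 ⟨x, rfl⟩)
  obtain ⟨s, hs, b, h'⟩ := exists_smul_of _ (nonneg_iff.2 ⟨y, rfl⟩)
  exact ⟨r, s, a, b, hr, hs, by rw [h, h']⟩

/-- The vector space spanned by a strongly archimedean convex effect algebra is an order unit
space. -/
theorem isOrderUnitSpace (hE : StronglyArchimedean E) :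
    OrderUnit.IsOrderUnitSpace (of (one : E)) where
  nonneg := of_nonneg _
  exists_le v := by
    obtain ⟨r, s, a, b, hr, hs, rfl⟩ := exists_sub_of v
    obtain ⟨n, hn⟩ := exists_nat_ge r
    refine ⟨n, ?_⟩
    calc r • of a - s • of b ≤ r • of a := sub_le_self _ (smul_nonneg hs (of_nonneg b))
      _ ≤ r • of one := smul_le_smul_of_nonneg_left (of_le_of.2 (le_one a)) hr
      _ ≤ (n : ℝ) • of one := smul_le_smul_of_nonneg_right hn (of_nonneg _)
      _ = n • of one := Nat.cast_smul_eq_nsmul ℝ n _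
  archimedean v w h := by
    obtain ⟨r, s, a, b, hr, hs, rfl⟩ := exists_sub_of v
    obtain ⟨q, q', c, d, hq, hq', rfl⟩ := exists_sub_of w
    -- Division by `T` brings `r a`, `s b` and `q c` into `E` and keeps `s/T + q/T ≤ 1`, so that the
    -- sums required by strong archimedeanity are defined.
    set T : ℝ := r + s + q + 1
    have hT : 0 < T := by positivity
    have hrT : r / T ≤ 1 := (div_le_one hT).2 (by simp only [T]; linarith)
    have hsT : s / T ≤ 1 := (div_le_one hT).2 (by simp only [T]; linarith)
    have hqT : q / T ≤ 1 := (div_le_one hT).2 (by simp only [T]; linarith)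
    have key : Le (rscale (r / T) a) (rscale (s / T) b) := by
      refine hE _ _ (rscale (q / T) c) fun n => ?_
      have hn : (0 : ℝ) < n + 1 := by positivity
      have hn' : 1 / ((n : ℝ) + 1) ≤ 1 := (recip n).2.2
      rw [← rscale_coe, recip, rscale_rscale (by positivity) hn' (by positivity) hqT]
      have hm : 1 / ((n : ℝ) + 1) * (q / T) ≤ q / T :=
        mul_le_of_le_one_left (by positivity) hn'
      obtain ⟨e, he⟩ := exists_osum_rscale (s := s / T) (t := 1 / ((n : ℝ) + 1) * (q / T))
        (by positivity) (by positivity) (by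
          have : s / T + q / T ≤ 1 := by
            rw [← add_div, div_le_one hT]
            simp only [T]
            linarith
          linarith) b c
      refine ⟨e, he, of_le_of.1 ?_⟩
      rw [of_osum he, of_rscale (by positivity) hrT, of_rscale (by positivity) hsT,
        of_rscale (by positivity) (hm.trans hqT)]
      -- The subtracted part `q' d` of the bound is dropped; division by `(n + 1) T` then gives
      -- exactly the inequality required in `E`.
      have h₁ := (h (n + 1)).trans (sub_le_self _ (smul_nonneg hq' (of_nonneg d)))
      rw [← Nat.cast_smul_eq_nsmul ℝ] at h₁
      have h₂ := smul_le_smul_of_nonneg_left h₁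
        (show (0 : ℝ) ≤ 1 / ((n : ℝ) + 1) * (1 / T) by positivity)
      rw [smul_smul, smul_sub, smul_smul, smul_smul, smul_smul, sub_le_iff_le_add'] at h₂
      convert h₂ using 2
      · push_cast
        field_simp
      · push_cast
        congr 1
        field_simp
      · congr 1
        field_simp
    have h₁ := smul_le_smul_of_nonneg_left (of_le_of.2 key) hT.le
    rw [of_rscale (by positivity) hrT, of_rscale (by positivity) hsT, smul_smul, smul_smul,
      mul_div_cancel₀ _ hT.ne', mul_div_cancel₀ _ hT.ne'] at h₁
    exact sub_nonpos.2 h₁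

variable (E) in
/-- A convex effect algebra is the unit interval of the vector space it spans. -/
noncomputable def intervalIso : IntervalIso E (Envelope E) (of one) where
  toFun := of
  mem_Icc a := ⟨of_nonneg a, of_le_of.2 (le_one a)⟩
  surj _ hv := exists_of_eq hv.1 hv.2
  map_one := rfl
  map_osum _ _ _ := of_osum
  reflects _ _ := exists_osum_of_le
  map_scale l a := by rw [← rscale_coe, of_rscale l.2.1 l.2.2]

end Envelope

end ConvexEffectAlgebra

/-! ### Linear extension of additive maps from the unit interval. -/

namespace OrderUnit

variable {V : Type*} [AddCommGroup V] [PartialOrder V] [IsOrderedAddMonoid V]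
  [Module ℝ V] [IsOrderedModule ℝ V] {u : V}

namespace IsOrderUnitSpace

theorem exists_bound (hu : IsOrderUnitSpace u) (v : V) :
    ∃ r : ℝ, 0 < r ∧ -(r • u) ≤ v ∧ v ≤ r • u := by
  obtain ⟨n, hn⟩ := hu.exists_le v
  obtain ⟨m, hm⟩ := hu.exists_le (-v)
  rw [← Nat.cast_smul_eq_nsmul ℝ] at hn hm
  refine ⟨n + m + 1, by positivity, neg_le.1 (hm.trans ?_), hn.trans ?_⟩ <;>
  · refine smul_le_smul_of_nonneg_right ?_ hu.nonneg
    linarith [(Nat.cast_nonneg n : (0 : ℝ) ≤ n), (Nat.cast_nonneg m : (0 : ℝ) ≤ m)]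

theorem inv_smul_mem {v : V} (hv : 0 ≤ v) {r : ℝ} (hr : 0 < r) (h : v ≤ r • u) :
    r⁻¹ • v ∈ Set.Icc 0 u := by
  refine ⟨smul_nonneg (inv_nonneg.2 hr.le) hv, ?_⟩
  have := smul_le_smul_of_nonneg_left h (inv_nonneg.2 hr.le)
  rwa [inv_smul_smul₀ hr.ne'] at this

theorem exists_eq_smul (hu : IsOrderUnitSpace u) {v : V} (hv : 0 ≤ v) :
    ∃ r : ℝ, 0 < r ∧ ∃ a ∈ Set.Icc 0 u, v = r • a := by
  obtain ⟨r, hr, -, h⟩ := hu.exists_bound v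
  exact ⟨r, hr, _, inv_smul_mem hv hr h, (smul_inv_smul₀ hr.ne' v).symm⟩

theorem exists_eq_smul_sub (hu : IsOrderUnitSpace u) (v : V) :
    ∃ r s : ℝ, 0 < r ∧ ∃ a ∈ Set.Icc 0 u, v = r • a - s • u := by
  obtain ⟨s, hs, h, -⟩ := hu.exists_bound v
  obtain ⟨r, hr, a, ha, h'⟩ := hu.exists_eq_smul (neg_le_iff_add_nonneg.1 h)
  exact ⟨r, s, hr, a, ha, by rw [← h', add_sub_cancel_right]⟩

theorem unit_mem (hu : IsOrderUnitSpace u) : u ∈ Set.Icc 0 u := ⟨hu.nonneg, le_rfl⟩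

theorem linearMap_ext (hu : IsOrderUnitSpace u) {L M : V →ₗ[ℝ] V}
    (h : ∀ a ∈ Set.Icc 0 u, L a = M a) : L = M := by
  ext v
  obtain ⟨r, s, -, a, ha, rfl⟩ := hu.exists_eq_smul_sub v
  simp only [map_sub, map_smul, h a ha, h u hu.unit_mem]

theorem le_zero_of_forall_half_pow (hu : IsOrderUnitSpace u) {v w : V} (hw : 0 ≤ w)
    (h : ∀ n : ℕ, v ≤ (1 / 2 : ℝ) ^ n • w) : v ≤ 0 := by
  refine hu.archimedean v w fun n => ?_
  have hn : (n : ℝ) ≤ 2 ^ n := by exact_mod_cast n.lt_two_pow_self.le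
  have h₁ := smul_le_smul_of_nonneg_left (h n) (Nat.cast_nonneg n : (0 : ℝ) ≤ n)
  rw [Nat.cast_smul_eq_nsmul, smul_smul] at h₁
  refine h₁.trans ((smul_le_smul_of_nonneg_right ?_ hw).trans_eq (one_smul ℝ w))
  rw [one_div, inv_pow, ← div_eq_mul_inv, div_le_one (by positivity)]
  exact hn

/-- An additive positive map on the unit interval is homogeneous. -/
theorem map_smul_of_additive (hu : IsOrderUnitSpace u) {f : V → V}
    (hpos : ∀ a ∈ Set.Icc 0 u, 0 ≤ f a)
    (hadd : ∀ a b, 0 ≤ a → 0 ≤ b → a + b ≤ u → f (a + b) = f a + f b)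
    {a : V} (ha : a ∈ Set.Icc 0 u) {t : ℝ} (ht : 0 ≤ t) (ht' : t ≤ 1) :
    f (t • a) = t • f a := by
  have hnat : ∀ (k : ℕ) (x : V), 0 ≤ x → (k : ℝ) • x ≤ u → f ((k : ℝ) • x) = (k : ℝ) • f x := by
    intro k x hx
    induction k with
    | zero =>
      intro _
      have := hadd 0 0 le_rfl le_rfl (by rw [add_zero]; exact hu.nonneg)
      simpa using this
    | succ k ih =>
      intro h
      rw [Nat.cast_succ, add_smul, one_smul] at h ⊢
      rw [hadd _ _ (smul_nonneg k.cast_nonneg hx) hx h, ih ((le_add_of_nonneg_right hx).trans h),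
        add_smul, one_smul]
  have hfa := hpos a ha
  -- With `x = a/n` and `k = ⌊t n⌋`, both `f (t a)` and `t f(a)` lie between `k f(x)` and `(k + 1)
  -- f(x)`, so they differ by at most `f(x) = f(a)/n` either way.
  have key : ∀ n : ℕ, n • (f (t • a) - t • f a) ≤ f a ∧ n • (t • f a - f (t • a)) ≤ f a := by
    intro n
    rcases n.eq_zero_or_pos with rfl | hn
    · simpa using hfa
    have hn' : (0 : ℝ) < n := Nat.cast_pos.2 hn
    set x := (n : ℝ)⁻¹ • a with hx
    have hx0 : 0 ≤ x := smul_nonneg (inv_nonneg.2 hn'.le) ha.1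
    have hnx : (n : ℝ) • x = a := smul_inv_smul₀ hn'.ne' a
    have hfx : f a = (n : ℝ) • f x := by
      rw [← hnat n x hx0 (hnx.trans_le ha.2), hnx]
    set k := ⌊t * n⌋₊
    have hk : (k : ℝ) ≤ t * n := Nat.floor_le (by positivity)
    have hk' : t * n < k + 1 := Nat.lt_floor_add_one _
    have hta : t • a = (k : ℝ) • x + (t * n - k) • x := by
      rw [← add_smul, add_sub_cancel, mul_smul, hnx]
    have htu : t • a ≤ u := (smul_le_of_le_one_left ha.1 ht').trans ha.2
    have hy : 0 ≤ (t * n - k) • x := smul_nonneg (by linarith) hx0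
    have hyx : (t * n - k) • x ≤ x := smul_le_of_le_one_left hx0 (by linarith)
    have hxu : x ≤ u := (smul_le_of_le_one_left ha.1 (inv_le_one_of_one_le₀
      (by exact_mod_cast hn))).trans ha.2
    have hkx : 0 ≤ (k : ℝ) • x := smul_nonneg k.cast_nonneg hx0
    have hf : f (t • a) = (k : ℝ) • f x + f ((t * n - k) • x) := by
      rw [hta, hadd _ _ hkx hy (hta ▸ htu),
        hnat k x hx0 ((le_add_of_nonneg_right hy).trans (hta ▸ htu))]
    have hfy : 0 ≤ f ((t * n - k) • x) := hpos _ ⟨hy, hyx.trans hxu⟩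
    have hfyx : f ((t * n - k) • x) ≤ f x := by
      have h₁ := hadd ((t * n - k) • x) (x - (t * n - k) • x) hy (sub_nonneg.2 hyx)
        (by rw [add_sub_cancel]; exact hxu)
      rw [add_sub_cancel] at h₁
      rw [h₁]
      exact le_add_of_nonneg_right (hpos _ ⟨sub_nonneg.2 hyx, (sub_le_self _ hy).trans hxu⟩)
    have hfx0 : 0 ≤ f x := hpos x ⟨hx0, hxu⟩
    have htf : t • f a = (k : ℝ) • f x + (t * n - k) • f x := by
      rw [← add_smul, add_sub_cancel, hfx, smul_smul]
    have hz : 0 ≤ (t * n - k) • f x := smul_nonneg (by linarith) hfx0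
    have hz' : (t * n - k) • f x ≤ f x := smul_le_of_le_one_left hfx0 (by linarith)
    rw [← Nat.cast_smul_eq_nsmul ℝ, ← Nat.cast_smul_eq_nsmul ℝ, hf, htf, add_sub_add_left_eq_sub,
      add_sub_add_left_eq_sub]
    refine ⟨?_, ?_⟩
    · calc _ ≤ (n : ℝ) • f x :=
          smul_le_smul_of_nonneg_left ((sub_le_self _ hz).trans hfyx) hn'.le
        _ = f a := hfx.symm
    · calc _ ≤ (n : ℝ) • f x :=
          smul_le_smul_of_nonneg_left ((sub_le_self _ hfy).trans hz') hn'.le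
        _ = f a := hfx.symm
  exact le_antisymm (sub_nonpos.1 (hu.archimedean _ _ fun n => (key n).1))
    (sub_nonpos.1 (hu.archimedean _ _ fun n => (key n).2))

/-- A map on the positive cone that is additive and homogeneous extends to a linear map. -/
theorem exists_linear_of_cone (hu : IsOrderUnitSpace u) {g : V → V}
    (hadd : ∀ v w, 0 ≤ v → 0 ≤ w → g (v + w) = g v + g w)
    (hsmul : ∀ (r : ℝ) v, 0 ≤ r → 0 ≤ v → g (r • v) = r • g v) :
    ∃ L : V →ₗ[ℝ] V, ∀ v, 0 ≤ v → L v = g v := by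
  have hdec : ∀ v : V, ∃ x y, 0 ≤ x ∧ 0 ≤ y ∧ v = x - y := by
    intro v
    obtain ⟨r, s, hr, a, ha, rfl⟩ := hu.exists_eq_smul_sub v
    rcases le_total 0 s with hs | hs
    · exact ⟨_, _, smul_nonneg hr.le ha.1, smul_nonneg hs hu.nonneg, rfl⟩
    · refine ⟨r • a - s • u, 0, ?_, le_rfl, (sub_zero _).symm⟩
      rw [sub_eq_add_neg, ← neg_smul]
      exact add_nonneg (smul_nonneg hr.le ha.1) (smul_nonneg (neg_nonneg.2 hs) hu.nonneg)
  choose x y hx hy hxy using hdec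
  -- The candidate value is independent of how `v` is written as a difference of positive elements.
  have key : ∀ v p q, 0 ≤ p → 0 ≤ q → v = p - q → g (x v) - g (y v) = g p - g q := by
    intro v p q hp hq h
    rw [sub_eq_sub_iff_add_eq_add, ← hadd _ _ (hx v) hq, ← hadd _ _ hp (hy v)]
    congr 1
    rw [← sub_eq_sub_iff_add_eq_add, ← hxy, h]
  have hmul : ∀ (r : ℝ) v, 0 ≤ r → g (x (r • v)) - g (y (r • v)) = r • (g (x v) - g (y v)) := by
    intro r v hr
    rw [smul_sub, ← hsmul r _ hr (hx v), ← hsmul r _ hr (hy v)]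
    refine key _ _ _ (smul_nonneg hr (hx v)) (smul_nonneg hr (hy v)) ?_
    rw [← smul_sub, ← hxy]
  refine ⟨{ toFun v := g (x v) - g (y v), map_add' v w := ?_, map_smul' r v := ?_ }, fun v hv => ?_⟩
  · rw [key (v + w) (x v + x w) (y v + y w) (add_nonneg (hx v) (hx w)) (add_nonneg (hy v) (hy w)),
      hadd _ _ (hx v) (hx w), hadd _ _ (hy v) (hy w)]
    · abel
    · conv_lhs => rw [hxy v, hxy w]
      abel
  · rcases le_total 0 r with hr | hr
    · exact hmul r v hr
    · have h := hmul (-r) v (neg_nonneg.2 hr)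
      rw [RingHom.id_apply, ← neg_neg r, neg_smul (-r) (g (x v) - g (y v)), ← h, neg_sub]
      refine key _ _ _ (hy _) (hx _) ?_
      rw [neg_smul (-r) v, ← neg_sub, ← hxy]
  · change g (x v) - g (y v) = g v
    have h0 : g 0 = 0 := by simpa using hadd 0 0 le_rfl le_rfl
    rw [key v v 0 hv le_rfl (sub_zero v).symm, h0, sub_zero]

/-- An additive positive map on the unit interval extends to a linear map. -/
theorem exists_linear_extension (hu : IsOrderUnitSpace u) {f : V → V}
    (hpos : ∀ a ∈ Set.Icc 0 u, 0 ≤ f a)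
    (hadd : ∀ a b, 0 ≤ a → 0 ≤ b → a + b ≤ u → f (a + b) = f a + f b) :
    ∃ L : V →ₗ[ℝ] V, ∀ a ∈ Set.Icc 0 u, L a = f a := by
  choose N hN _ hNu using hu.exists_bound
  have hle : ∀ v {r s : ℝ}, 0 ≤ v → 0 < r → r ≤ s → v ≤ r • u →
      s • f (s⁻¹ • v) = r • f (r⁻¹ • v) := by
    intro v r s hv hr hrs h
    have hs : 0 < s := hr.trans_le hrs
    have e : s⁻¹ • v = (r / s) • r⁻¹ • v := by
      rw [smul_smul]
      congr 1
      field_simp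
    rw [e, hu.map_smul_of_additive hpos hadd (inv_smul_mem hv hr h) (by positivity)
      ((div_le_one hs).2 hrs), smul_smul, mul_div_cancel₀ _ hs.ne']
  -- The value `r f(v/r)` is the same for every admissible scale `r`; two scales are compared
  -- through their sum. Elements can thus be evaluated at a common scale.
  have hg : ∀ v {r : ℝ}, 0 ≤ v → 0 < r → v ≤ r • u →
      N v • f ((N v)⁻¹ • v) = r • f (r⁻¹ • v) := by
    intro v r hv hr h
    rw [← hle v hv hr (le_add_of_nonneg_right (hN v).le) h,
      ← hle v hv (hN v) (le_add_of_nonneg_left hr.le) (hNu v)]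
  obtain ⟨L, hL⟩ := hu.exists_linear_of_cone (g := fun v => N v • f ((N v)⁻¹ • v))
    (by
      intro v w hv hw
      have hr : 0 < N v + N w := add_pos (hN v) (hN w)
      have hvw : v + w ≤ (N v + N w) • u := by
        rw [add_smul]
        exact add_le_add (hNu v) (hNu w)
      have hv' : v ≤ (N v + N w) • u := (le_add_of_nonneg_right hw).trans hvw
      have hw' : w ≤ (N v + N w) • u := (le_add_of_nonneg_left hv).trans hvw
      have hm := inv_smul_mem (add_nonneg hv hw) hr hvw
      rw [hg (v + w) (add_nonneg hv hw) hr hvw, hg v hv hr hv', hg w hw hr hw', ← smul_add]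
      congr 1
      rw [smul_add] at hm ⊢
      exact hadd _ _ (inv_smul_mem hv hr hv').1 (inv_smul_mem hw hr hw').1 hm.2)
    (by
      intro r v hr hv
      -- The factor `r + 1` rather than `r` keeps the scale positive when `r = 0`.
      have hv' : r • v ≤ ((r + 1) * N v) • u := by
        rw [mul_smul]
        exact (smul_le_smul_of_nonneg_left (hNu v) hr).trans (smul_le_smul_of_nonneg_right
          (by linarith) (smul_nonneg (hN v).le hu.nonneg))
      have hr' : 0 < r + 1 := by positivity
      rw [hg (r • v) (smul_nonneg hr hv) (mul_pos hr' (hN v)) hv']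
      have e : ((r + 1) * N v)⁻¹ • r • v = (r / (r + 1)) • (N v)⁻¹ • v := by
        rw [smul_smul, smul_smul]
        congr 1
        field_simp
      rw [e, hu.map_smul_of_additive hpos hadd (inv_smul_mem hv (hN v) (hNu v)) (by positivity)
        ((div_le_one hr').2 (by linarith)), smul_smul, smul_smul]
      congr 1
      field_simp)
  refine ⟨L, fun a ha => ?_⟩
  rw [hL a ha.1, hg a ha.1 one_pos (by rw [one_smul]; exact ha.2), one_smul, inv_one, one_smul]

end IsOrderUnitSpace

end OrderUnit

/-! ### Extensionality of compression bases. -/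

theorem EffectAlgebra.CompressionBase.ext' {E : Type*} [EffectAlgebra E] {b c : CompressionBase E}
    (hP : b.P = c.P) (hJ : ∀ p (hb : p ∈ b.P) (hc : p ∈ c.P), b.J ⟨p, hb⟩ = c.J ⟨p, hc⟩) :
    b = c := by
  obtain ⟨P, _, J, _, _, _⟩ := b
  obtain ⟨P', _, J', _, _, _⟩ := c
  obtain rfl : P = P' := hP
  obtain rfl : J = J' := funext fun p => hJ p p.2 p.2
  rfl

theorem OrderUnit.CompressionBase.ext' {V : Type*} [AddCommGroup V] [PartialOrder V] [Module ℝ V]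
    {u : V} {b c : CompressionBase u}
    (hP : b.P = c.P) (hJ : ∀ p (hb : p ∈ b.P) (hc : p ∈ c.P), b.J ⟨p, hb⟩ = c.J ⟨p, hc⟩) :
    b = c := by
  obtain ⟨P, _, J, _, _, _⟩ := b
  obtain ⟨P', _, J', _, _, _⟩ := c
  obtain rfl : P = P' := hP
  obtain rfl : J = J' := funext fun p => hJ p p.2 p.2
  rfl

/-! ### The correspondence of compressions and of compression bases. -/

namespace IntervalIso

open EffectAlgebra ConvexEffectAlgebra

variable {E : Type*} [EffectAlgebra E] [ConvexEffectAlgebra E]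
  {V : Type*} [AddCommGroup V] [PartialOrder V] [IsOrderedAddMonoid V]
  [Module ℝ V] [IsOrderedModule ℝ V] {u : V} (φ : IntervalIso E V u)

theorem map_compl (a : E) : φ.toFun (compl a) = u - φ.toFun a := by
  refine eq_sub_of_add_eq' ?_
  rw [← φ.map_osum _ _ _ (osum_compl a), φ.map_one]

theorem eq_zero_of_map_eq_zero {a : E} (h : φ.toFun a = 0) : a = zero := by
  obtain ⟨c, hc⟩ := φ.reflects a one (by rw [h, φ.map_one, zero_add])
  exact eq_zero_of_osum_one _ _ hc

/-- If `a` and `b` have the same image, `a ⊕ b'` is defined with image `u`. Its complement has image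
`0`, hence is `0`, so `a ⊕ b' = 1` and `a = b`. -/
theorem injective : Function.Injective φ.toFun := fun a b h => by
  have hu : φ.toFun a + φ.toFun (compl b) = u := by rw [h, φ.map_compl, add_sub_cancel]
  obtain ⟨c, hc⟩ := φ.reflects a (compl b) hu.le
  have hc' : compl c = zero := φ.eq_zero_of_map_eq_zero (by
    rw [φ.map_compl, φ.map_osum _ _ _ hc, hu, sub_self])
  rw [← EffectAlgebra.compl_compl c, hc', compl_zero, osum_eq_one_iff] at hc
  rw [← EffectAlgebra.compl_compl a, ← hc, EffectAlgebra.compl_compl]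

theorem osum_eq_some_iff {a b c : E} :
    osum a b = some c ↔ φ.toFun c = φ.toFun a + φ.toFun b := by
  refine ⟨φ.map_osum a b c, fun h => ?_⟩
  obtain ⟨d, hd⟩ := φ.reflects a b (h ▸ (φ.mem_Icc c).2)
  rw [hd, φ.injective ((φ.map_osum _ _ _ hd).trans h.symm)]

theorem map_zero : φ.toFun zero = 0 := by
  rw [← compl_one, φ.map_compl, φ.map_one, sub_self]

theorem le_iff {a b : E} : Le a b ↔ φ.toFun a ≤ φ.toFun b := by
  constructor
  · rintro ⟨c, hc⟩
    rw [φ.map_osum _ _ _ hc]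
    exact le_add_of_nonneg_right (φ.mem_Icc c).1
  · intro h
    obtain ⟨c, hc⟩ := φ.surj (φ.toFun b - φ.toFun a)
      ⟨sub_nonneg.2 h, (sub_le_self _ (φ.mem_Icc a).1).trans (φ.mem_Icc b).2⟩
    exact ⟨c, φ.osum_eq_some_iff.2 (by rw [hc, add_sub_cancel])⟩

theorem mackeyCompatible_iff {a b : E} :
    MackeyCompatible a b ↔ OrderUnit.MackeyCompatible u (φ.toFun a) (φ.toFun b) := by
  constructor
  · rintro ⟨a₁, b₁, c, s, t, h₁, h₂, h₃, h₄⟩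
    rw [φ.osum_eq_some_iff] at h₁ h₂ h₃ h₄
    exact ⟨φ.toFun a₁, φ.toFun b₁, φ.toFun c, (φ.mem_Icc _).1, (φ.mem_Icc _).1, (φ.mem_Icc _).1,
      by rw [← h₃, ← h₄]; exact (φ.mem_Icc t).2, h₁, h₂⟩
  · rintro ⟨a₁, b₁, c, ha, hb, hc, hu, h₁, h₂⟩
    have hab : a₁ + b₁ ≤ u := (le_add_of_nonneg_right hc).trans hu
    obtain ⟨s, hs⟩ := φ.surj (a₁ + b₁) ⟨add_nonneg ha hb, hab⟩
    obtain ⟨t, ht⟩ := φ.surj (a₁ + b₁ + c) ⟨add_nonneg (add_nonneg ha hb) hc, hu⟩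
    obtain ⟨a₁, rfl⟩ := φ.surj a₁ ⟨ha, (le_add_of_nonneg_right hb).trans hab⟩
    obtain ⟨b₁, rfl⟩ := φ.surj b₁ ⟨hb, (le_add_of_nonneg_left ha).trans hab⟩
    obtain ⟨c, rfl⟩ := φ.surj c ⟨hc, (le_add_of_nonneg_left (add_nonneg ha hb)).trans hu⟩
    refine ⟨a₁, b₁, c, s, t, ?_, ?_, ?_, ?_⟩ <;> rw [φ.osum_eq_some_iff]
    exacts [h₁, h₂, hs, by rw [ht, hs]]

theorem extends_unit {J : E → E} {L : V →ₗ[ℝ] V} (h : φ.Extends J L) :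
    L u = φ.toFun (J one) :=
  (congrArg L φ.map_one).symm.trans (h one)

theorem isCompression_iff (hu : OrderUnit.IsOrderUnitSpace u) {J : E → E} {L : V →ₗ[ℝ] V}
    (h : φ.Extends J L) : IsCompression J ↔ OrderUnit.IsCompression u L := by
  have h₁ := φ.extends_unit h
  constructor
  · rintro ⟨⟨-, hr⟩, hk⟩
    refine ⟨fun v hv => ?_, h₁ ▸ (φ.mem_Icc _).2, fun v hv hle => ?_, fun v hv => ?_⟩
    · obtain ⟨r, hr, a, ha, rfl⟩ := hu.exists_eq_smul hv
      obtain ⟨x, rfl⟩ := φ.surj a ha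
      rw [map_smul, h]
      exact smul_nonneg hr.le (φ.mem_Icc _).1
    · obtain ⟨x, rfl⟩ := φ.surj v hv
      rw [h, hr x (φ.le_iff.2 (h₁ ▸ hle))]
    · obtain ⟨x, rfl⟩ := φ.surj v hv
      rw [h, h₁, ← φ.map_compl, ← φ.le_iff, ← hk, ← φ.map_zero, φ.injective.eq_iff]
  · intro hL
    refine ⟨⟨fun a b c habc => ?_, fun a ha => φ.injective ?_⟩, fun a => ?_⟩
    · rw [φ.osum_eq_some_iff] at habc ⊢
      rw [← h, ← h, ← h, habc, map_add]
    · rw [← h]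
      exact hL.retract _ (φ.mem_Icc a) (h₁ ▸ φ.le_iff.1 ha)
    · rw [φ.le_iff, φ.map_compl, ← h₁, ← hL.ker_iff _ (φ.mem_Icc a), h, ← φ.map_zero,
        φ.injective.eq_iff]

theorem extends_unique_linear (hu : OrderUnit.IsOrderUnitSpace u) {J : E → E} {L M : V →ₗ[ℝ] V}
    (hL : φ.Extends J L) (hM : φ.Extends J M) : L = M :=
  hu.linearMap_ext fun a ha => by
    obtain ⟨x, rfl⟩ := φ.surj a ha
    rw [hL, hM]

theorem extends_unique {J K : E → E} {L : V →ₗ[ℝ] V}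
    (hJ : φ.Extends J L) (hK : φ.Extends K L) : J = K :=
  funext fun a => φ.injective (by rw [← hJ, hK])

theorem exists_extension (hu : OrderUnit.IsOrderUnitSpace u) {J : E → E} (hJ : IsAdditive J) :
    ∃ L : V →ₗ[ℝ] V, φ.Extends J L := by
  choose ψ hψ using fun v : Set.Icc 0 u => φ.surj v v.2
  classical
  -- The map is transported to `[0, u]` and set to `0` elsewhere; the outside value never matters.
  have hf : ∀ x : E, (if h : φ.toFun x ∈ Set.Icc 0 u then φ.toFun (J (ψ ⟨φ.toFun x, h⟩)) else 0)
      = φ.toFun (J x) := fun x => by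
    rw [dif_pos (φ.mem_Icc x), φ.injective (hψ ⟨φ.toFun x, φ.mem_Icc x⟩)]
  obtain ⟨L, hL⟩ := hu.exists_linear_extension
    (f := fun v => if h : v ∈ Set.Icc 0 u then φ.toFun (J (ψ ⟨v, h⟩)) else 0)
    (fun a ha => by
      obtain ⟨x, rfl⟩ := φ.surj a ha
      exact (φ.mem_Icc (J x)).1.trans_eq (hf x).symm)
    (fun a b ha hb hab => by
      obtain ⟨z, hz⟩ := φ.surj (a + b) ⟨add_nonneg ha hb, hab⟩
      obtain ⟨x, rfl⟩ := φ.surj a ⟨ha, (le_add_of_nonneg_right hb).trans hab⟩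
      obtain ⟨y, rfl⟩ := φ.surj b ⟨hb, (le_add_of_nonneg_left ha).trans hab⟩
      have h := hJ _ _ _ (φ.osum_eq_some_iff.2 hz)
      rw [← hz]
      exact (hf z).trans ((φ.map_osum _ _ _ h).trans (congrArg₂ _ (hf x) (hf y)).symm))
  exact ⟨L, fun a => (hL _ (φ.mem_Icc a)).trans (hf a)⟩

theorem exists_restriction {L : V →ₗ[ℝ] V} (hL : OrderUnit.IsCompression u L) :
    ∃ J : E → E, φ.Extends J L := by
  have h : ∀ a : E, ∃ x, φ.toFun x = L (φ.toFun a) := fun a => by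
    refine φ.surj _ ⟨hL.positive _ (φ.mem_Icc a).1, le_trans ?_ hL.le_unit⟩
    rw [← sub_nonneg, ← map_sub]
    exact hL.positive _ (sub_nonneg.2 (φ.mem_Icc a).2)
  choose J hJ using h
  exact ⟨J, fun a => (hJ a).symm⟩

theorem existsUnique_compression_extension (hu : OrderUnit.IsOrderUnitSpace u) {J : E → E}
    (hJ : IsCompression J) :
    ∃! L : V →ₗ[ℝ] V, OrderUnit.IsCompression u L ∧ φ.Extends J L := by
  obtain ⟨L, hL⟩ := φ.exists_extension hu hJ.1.1
  exact ⟨L, ⟨(φ.isCompression_iff hu hL).1 hJ, hL⟩,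
    fun M hM => φ.extends_unique_linear hu hM.2 hL⟩

theorem existsUnique_compression_restriction (hu : OrderUnit.IsOrderUnitSpace u) {L : V →ₗ[ℝ] V}
    (hL : OrderUnit.IsCompression u L) :
    ∃! J : E → E, IsCompression J ∧ φ.Extends J L := by
  obtain ⟨J, hJ⟩ := φ.exists_restriction hL
  exact ⟨J, ⟨(φ.isCompression_iff hu hJ).2 hL, hJ⟩, fun K hK => φ.extends_unique hK.2 hJ⟩

theorem isSubEffectAlgebra_image {P : Set E} (hP : IsSubEffectAlgebra P) :
    OrderUnit.IsSubEffectAlgebra u (φ.toFun '' P) where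
  subset := by
    rintro _ ⟨a, -, rfl⟩
    exact φ.mem_Icc a
  zero_mem := ⟨zero, hP.zero_mem, φ.map_zero⟩
  unit_mem := ⟨one, hP.one_mem, φ.map_one⟩
  compl_mem := by
    rintro _ ⟨a, ha, rfl⟩
    exact ⟨_, hP.compl_mem a ha, φ.map_compl a⟩
  add_mem := by
    rintro _ ⟨a, ha, rfl⟩ _ ⟨b, hb, rfl⟩ h
    obtain ⟨c, hc⟩ := φ.reflects a b h
    exact ⟨c, hP.osum_mem a ha b hb c hc, φ.map_osum _ _ _ hc⟩

theorem isSubEffectAlgebra_preimage {P : Set V} (hP : OrderUnit.IsSubEffectAlgebra u P) :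
    IsSubEffectAlgebra (φ.toFun ⁻¹' P) where
  zero_mem := by
    rw [Set.mem_preimage, φ.map_zero]
    exact hP.zero_mem
  one_mem := by
    rw [Set.mem_preimage, φ.map_one]
    exact hP.unit_mem
  compl_mem a ha := by
    rw [Set.mem_preimage, φ.map_compl]
    exact hP.compl_mem _ ha
  osum_mem a ha b hb c hc := by
    have h := φ.map_osum _ _ _ hc
    rw [Set.mem_preimage, h]
    exact hP.add_mem _ ha _ hb (h ▸ (φ.mem_Icc c).2)

theorem existsUnique_base_extension (hu : OrderUnit.IsOrderUnitSpace u)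
    (b : EffectAlgebra.CompressionBase E) :
    ∃! c : OrderUnit.CompressionBase u, φ.ExtendsBase b c := by
  choose L hL using fun p : b.P => φ.exists_extension hu (b.isCompression p).1.1
  choose ψ hψP hψ using fun q : φ.toFun '' b.P => q.2
  have hψ' : ∀ (p : b.P) (q : φ.toFun '' b.P), (q : V) = φ.toFun p → ⟨ψ q, hψP q⟩ = p :=
    fun p q h => Subtype.ext (φ.injective ((hψ q).trans h))
  let c : OrderUnit.CompressionBase u :=
    { P := φ.toFun '' b.P
      isSubEffectAlgebra := φ.isSubEffectAlgebra_image b.isSubEffectAlgebra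
      J := fun q => L ⟨ψ q, hψP q⟩
      isCompression := fun q => (φ.isCompression_iff hu (hL _)).1 (b.isCompression _)
      focus := fun q => by rw [φ.extends_unit (hL _), b.focus, hψ]
      comp := fun p q h => by
        rw [← hψ p, ← hψ q, ← φ.mackeyCompatible_iff] at h
        obtain ⟨r, hr⟩ := b.comp ⟨ψ p, hψP p⟩ ⟨ψ q, hψP q⟩ h
        -- The composite of the extensions and the extension of `J_r` are linear and extend the same
        -- map of `E`, so they coincide.
        refine ⟨⟨φ.toFun r, r, r.2, rfl⟩, φ.extends_unique_linear hu (J := b.J r) ?_ ?_⟩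
        · intro a
          rw [LinearMap.comp_apply, hL, hL, ← hr]
          rfl
        · rw [hψ' r _ rfl]
          exact hL r }
  have hc : φ.ExtendsBase b c := ⟨rfl, fun p q hpq => by
    change φ.Extends (b.J p) (L ⟨ψ q, hψP q⟩)
    rw [hψ' p q hpq]
    exact hL p⟩
  refine ⟨c, hc, fun d hd => OrderUnit.CompressionBase.ext' (hd.1.trans hc.1.symm) ?_⟩
  rintro _ hp ⟨p, hpb, rfl⟩
  exact φ.extends_unique_linear hu (hd.2 ⟨p, hpb⟩ _ rfl) (hc.2 ⟨p, hpb⟩ _ rfl)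

theorem existsUnique_base_restriction (hu : OrderUnit.IsOrderUnitSpace u)
    (c : OrderUnit.CompressionBase u) :
    ∃! b : EffectAlgebra.CompressionBase E, φ.ExtendsBase b c := by
  choose J hJ using fun p : c.P => φ.exists_restriction (c.isCompression p)
  let b : EffectAlgebra.CompressionBase E :=
    { P := φ.toFun ⁻¹' c.P
      isSubEffectAlgebra := φ.isSubEffectAlgebra_preimage c.isSubEffectAlgebra
      J := fun p => J ⟨φ.toFun p, p.2⟩
      isCompression := fun p => (φ.isCompression_iff hu (hJ _)).2 (c.isCompression _)
      focus := fun p => φ.injective (by rw [← hJ, φ.map_one, c.focus])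
      comp := fun p q h => by
        rw [φ.mackeyCompatible_iff] at h
        obtain ⟨r, hr⟩ := c.comp ⟨φ.toFun p, p.2⟩ ⟨φ.toFun q, q.2⟩ h
        obtain ⟨x, hx⟩ := φ.surj r (c.isSubEffectAlgebra.subset r.2)
        obtain ⟨r, hr'⟩ := r
        obtain rfl : φ.toFun x = r := hx
        refine ⟨⟨x, hr'⟩, φ.extends_unique (L := c.J ⟨φ.toFun x, hr'⟩) ?_ (hJ _)⟩
        intro a
        rw [← hr, LinearMap.comp_apply, hJ, hJ]
        rfl }
  have hb : φ.ExtendsBase b c := by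
    refine ⟨(Set.image_preimage_eq_of_subset fun v hv => ?_).symm, fun p q hpq => ?_⟩
    · exact φ.surj v (c.isSubEffectAlgebra.subset hv)
    · obtain rfl : q = ⟨φ.toFun p, p.2⟩ := Subtype.ext hpq
      exact hJ _
  refine ⟨b, hb, fun d hd => EffectAlgebra.CompressionBase.ext'
    (φ.injective.image_injective (hd.1.symm.trans hb.1)) fun p hp hp' => ?_⟩
  exact φ.extends_unique (hd.2 ⟨p, hp⟩ ⟨φ.toFun p, hp'⟩ rfl) (hb.2 ⟨p, hp'⟩ ⟨φ.toFun p, hp'⟩ rfl)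

end IntervalIso

/-! ### Commuting projections and bicommutants in an order unit space. -/

namespace OrderUnit

variable {V : Type*} [AddCommGroup V] [PartialOrder V] [IsOrderedAddMonoid V]
  [Module ℝ V] [IsOrderedModule ℝ V] {u : V}

theorem MackeyCompatible.symm {a b : V} (h : MackeyCompatible u a b) : MackeyCompatible u b a := by
  obtain ⟨a₁, b₁, c, ha, hb, hc, hu, h₁, h₂⟩ := h
  exact ⟨b₁, a₁, c, hb, ha, hc, by rwa [add_comm b₁], h₂, h₁⟩

theorem IsCompression.monotone {J : V →ₗ[ℝ] V} (hJ : IsCompression u J) {v w : V} (h : v ≤ w) :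
    J v ≤ J w := by
  rw [← sub_nonneg, ← map_sub]
  exact hJ.positive _ (sub_nonneg.2 h)

namespace CompressionBase

variable (b : CompressionBase u)

theorem proj_nonneg (p : b.P) : (0 : V) ≤ p := (b.isSubEffectAlgebra.subset p.2).1

theorem proj_le (p : b.P) : (p : V) ≤ u := (b.isSubEffectAlgebra.subset p.2).2

theorem coe_perp (p : b.P) : (b.perp p : V) = u - p := rfl

theorem perp_perp (p : b.P) : b.perp (b.perp p) = p := Subtype.ext (sub_sub_cancel _ _)

theorem perp_le_perp {p q : b.P} (h : (p : V) ≤ q) : (b.perp q : V) ≤ b.perp p :=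
  sub_le_sub_left h u

theorem J_nonneg (p : b.P) {v : V} (hv : 0 ≤ v) : 0 ≤ b.J p v := (b.isCompression p).positive v hv

theorem J_mono (p : b.P) {v w : V} (h : v ≤ w) : b.J p v ≤ b.J p w := (b.isCompression p).monotone h

theorem J_le (p : b.P) {v : V} (hv : v ≤ u) : b.J p v ≤ p :=
  (b.J_mono p hv).trans_eq (b.focus p)

theorem J_eq_self (p : b.P) {v : V} (hv : 0 ≤ v) (h : v ≤ p) : b.J p v = v :=
  (b.isCompression p).retract v ⟨hv, h.trans (b.proj_le p)⟩ (by rwa [b.focus])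

theorem J_eq_zero_iff (p : b.P) {v : V} (hv : 0 ≤ v) (hv' : v ≤ u) :
    b.J p v = 0 ↔ v ≤ b.perp p := by
  rw [(b.isCompression p).ker_iff v ⟨hv, hv'⟩, b.focus, coe_perp]

theorem J_eq_zero (p : b.P) {v : V} (hv : 0 ≤ v) (h : v ≤ b.perp p) : b.J p v = 0 :=
  (b.J_eq_zero_iff p hv (h.trans (b.proj_le _))).2 h

theorem J_perp_eq_zero (p : b.P) {v : V} (hv : 0 ≤ v) (h : v ≤ p) : b.J (b.perp p) v = 0 :=
  b.J_eq_zero _ hv (by rwa [perp_perp])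

variable {b}

theorem J_comp_of_le (hu : IsOrderUnitSpace u) {p q : b.P} (h : (p : V) ≤ q) (v : V) :
    b.J q (b.J p v) = b.J p v :=
  LinearMap.congr_fun (f := b.J q ∘ₗ b.J p) (hu.linearMap_ext fun _ ha =>
    b.J_eq_self q (b.J_nonneg p ha.1) ((b.J_le p ha.2).trans h)) v

theorem J_perp_comp (hu : IsOrderUnitSpace u) (p : b.P) (v : V) :
    b.J (b.perp p) (b.J p v) = 0 :=
  LinearMap.congr_fun (f := b.J (b.perp p) ∘ₗ b.J p) (g := 0) (hu.linearMap_ext fun _ ha =>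
    b.J_perp_eq_zero p (b.J_nonneg p ha.1) (b.J_le p ha.2)) v

variable (b) in
/-- The commutant of a projection as a subspace. -/
def commutant (p : b.P) : Submodule ℝ V :=
  LinearMap.eqLocus LinearMap.id (b.J p + b.J (b.perp p))

theorem mem_commutant {p : b.P} {g : V} : g ∈ b.commutant p ↔ g ∈ b.C p := Iff.rfl

theorem mem_C_iff {p : b.P} {g : V} : g ∈ b.C p ↔ g = b.J p g + b.J (b.perp p) g := Iff.rfl

theorem mem_C_perp {p : b.P} {g : V} : g ∈ b.C (b.perp p) ↔ g ∈ b.C p := by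
  rw [mem_C_iff, mem_C_iff, perp_perp, add_comm]

theorem unit_mem_C (p : b.P) : u ∈ b.C p := by
  rw [mem_C_iff, b.focus, b.focus, coe_perp, add_sub_cancel]

theorem smul_sub_smul_unit_mem_C {p : b.P} {g : V} {r s : ℝ} (hr : r ≠ 0) :
    r • g - s • u ∈ b.C p ↔ g ∈ b.C p := by
  have hu : s • u ∈ b.commutant p := (b.commutant p).smul_mem s (unit_mem_C p)
  rw [← mem_commutant, Submodule.sub_mem_iff_left _ hu, Submodule.smul_mem_iff _ hr, mem_commutant]

/-- `J_q` fixes `c ≤ q` and kills `a ≤ q'`, while `J_{q'}` does the opposite. -/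
theorem J_eq_of_decomposition {p q : b.P} {a c e : V} (ha : 0 ≤ a) (hc : 0 ≤ c) (he : 0 ≤ e)
    (h : a + e + c ≤ u) (hp : (p : V) = a + c) (hq : (q : V) = e + c) :
    b.J q p = c ∧ b.J (b.perp q) p = a := by
  have hcq : c ≤ q := hq ▸ le_add_of_nonneg_left he
  have haq : a ≤ b.perp q := by
    rw [coe_perp, hq, le_sub_iff_add_le, ← add_assoc]
    exact h
  rw [hp, map_add, map_add, b.J_eq_self q hc hcq, b.J_eq_zero q ha haq, b.J_eq_self _ ha haq,
    b.J_perp_eq_zero q hc hcq, zero_add, add_zero]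
  exact ⟨rfl, rfl⟩

theorem mackeyCompatible_iff {p q : b.P} : MackeyCompatible u (p : V) q ↔ (p : V) ∈ b.C q := by
  constructor
  · rintro ⟨a, e, c, ha, he, hc, h, hp, hq⟩
    obtain ⟨h₁, h₂⟩ := J_eq_of_decomposition ha hc he h hp hq
    rw [mem_C_iff, h₁, h₂, hp, add_comm]
  · intro h
    -- The common part is `J_q p`; the remainders are `J_{q'} p ≤ q'` and `q - J_q p`, which fit
    -- together below `u`.
    refine ⟨b.J (b.perp q) p, q - b.J q p, b.J q p, b.J_nonneg _ (b.proj_nonneg p),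
      sub_nonneg.2 (b.J_le q (b.proj_le p)), b.J_nonneg _ (b.proj_nonneg p), ?_, ?_, ?_⟩
    · rw [add_assoc, sub_add_cancel, ← le_sub_iff_add_le]
      exact b.J_le (b.perp q) (b.proj_le p)
    · rw [add_comm]
      exact h
    · rw [sub_add_cancel]

theorem mem_C_symm {p q : b.P} (h : (p : V) ∈ b.C q) : (q : V) ∈ b.C p :=
  mackeyCompatible_iff.1 (mackeyCompatible_iff.2 h).symm

theorem J_proj_comm {p q : b.P} (h : (p : V) ∈ b.C q) : b.J q p = b.J p q := by
  obtain ⟨a, e, c, ha, he, hc, h, hp, hq⟩ := mackeyCompatible_iff.2 h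
  rw [(J_eq_of_decomposition ha hc he h hp hq).1,
    (J_eq_of_decomposition he hc ha (by rwa [add_comm e]) hq hp).1]

/-- For commuting projections `J_p q` is again a projection; it serves as their meet. -/
theorem exists_inf {p q : b.P} (h : (p : V) ∈ b.C q) :
    ∃ r : b.P, (r : V) = b.J p q ∧ ∀ v, b.J r v = b.J p (b.J q v) := by
  obtain ⟨r, hr⟩ := b.comp p q (mackeyCompatible_iff.2 h)
  refine ⟨r, ?_, fun v => ?_⟩
  · rw [← b.focus r, ← hr, LinearMap.comp_apply, b.focus]
  · rw [← hr, LinearMap.comp_apply]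

theorem J_eq_comp {p q r : b.P} (h : (p : V) ∈ b.C q) (hr : (r : V) = b.J p q) (v : V) :
    b.J r v = b.J p (b.J q v) := by
  obtain ⟨s, hs, hs'⟩ := exists_inf h
  obtain rfl : r = s := Subtype.ext (hr.trans hs.symm)
  exact hs' v

theorem J_comm {p q : b.P} (h : (p : V) ∈ b.C q) (v : V) :
    b.J p (b.J q v) = b.J q (b.J p v) := by
  obtain ⟨r, hr, hr'⟩ := exists_inf h
  rw [← hr', J_eq_comp (mem_C_symm h) (hr.trans (J_proj_comm h).symm)]

theorem mem_C_inf (hu : IsOrderUnitSpace u) {p q r : b.P} (h : (p : V) ∈ b.C q)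
    (hr : (r : V) = b.J p q) {g : V} (hp : g ∈ b.C p) (hq : g ∈ b.C q) : g ∈ b.C r := by
  have h' : (p : V) ∈ b.C (b.perp q) := mem_C_perp.2 h
  obtain ⟨a, ha, ha'⟩ := exists_inf h'
  have hrp : (r : V) ≤ p := hr.trans_le (b.J_le p (b.proj_le q))
  have har : (a : V) ≤ b.perp r := by
    rw [coe_perp, ha, hr, coe_perp, map_sub, b.focus]
    exact sub_le_sub_right (b.proj_le p) _
  -- Here `r = p ∧ q` and `a = p ∧ q'`. Both `a` and `p'` lie below `r'`, so applying `J_{r'}`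
  -- identifies the last two terms with `J_{r'} g`.
  have hg : g = b.J r g + b.J a g + b.J (b.perp p) g := by
    rw [J_eq_comp h hr, ha', ← map_add, ← mem_C_iff.1 hq]
    exact hp
  have key := congrArg (b.J (b.perp r)) hg
  rw [map_add, map_add, J_perp_comp hu, zero_add, J_comp_of_le hu har,
    J_comp_of_le hu (b.perp_le_perp hrp)] at key
  rw [mem_C_iff, key, ← add_assoc]
  exact hg

theorem mem_PC_iff {A : Set V} {p : b.P} : (p : V) ∈ b.PC A ↔ ∀ g ∈ A, g ∈ b.C p :=
  ⟨fun ⟨_, h⟩ => h, fun h => ⟨p.2, h⟩⟩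

theorem PC_subset (A : Set V) : b.PC A ⊆ b.P := fun _ h => h.1

theorem perp_mem_PC {A : Set V} {p : b.P} (h : (p : V) ∈ b.PC A) : (b.perp p : V) ∈ b.PC A :=
  mem_PC_iff.2 fun g hg => mem_C_perp.2 (mem_PC_iff.1 h g hg)

theorem inf_mem_PC (hu : IsOrderUnitSpace u) {A : Set V} {p q r : b.P} (h : (p : V) ∈ b.C q)
    (hr : (r : V) = b.J p q) (hp : (p : V) ∈ b.PC A) (hq : (q : V) ∈ b.PC A) :
    (r : V) ∈ b.PC A :=
  mem_PC_iff.2 fun g hg => mem_C_inf hu h hr (mem_PC_iff.1 hp g hg) (mem_PC_iff.1 hq g hg)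

theorem unit_mem_PC (hu : IsOrderUnitSpace u) (A : Set V) : u ∈ b.PC A := by
  refine ⟨b.isSubEffectAlgebra.unit_mem, fun g _ => ?_⟩
  set p : b.P := ⟨u, b.isSubEffectAlgebra.unit_mem⟩
  have h₁ : b.J p = LinearMap.id := hu.linearMap_ext fun a ha => b.J_eq_self p ha.1 ha.2
  have h₂ : b.J (b.perp p) g = 0 := by
    have := J_perp_comp hu p g
    rwa [h₁] at this
  rw [mem_C_iff, h₁, h₂, add_zero]
  rfl

/-- The projections commuting with a set form a sub-effect algebra. -/
theorem isSubEffectAlgebra_PC (hu : IsOrderUnitSpace u) (A : Set V) :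
    IsSubEffectAlgebra u (b.PC A) where
  subset := (PC_subset A).trans b.isSubEffectAlgebra.subset
  zero_mem := by
    have := perp_mem_PC (p := ⟨u, b.isSubEffectAlgebra.unit_mem⟩) (unit_mem_PC hu A)
    rwa [coe_perp, sub_self] at this
  unit_mem := unit_mem_PC hu A
  compl_mem a ha := perp_mem_PC (p := ⟨a, ha.1⟩) ha
  add_mem a ha c hc h := by
    lift a to b.P using ha.1
    lift c to b.P using hc.1
    have hac : (c : V) ≤ b.perp a := by
      rw [coe_perp, le_sub_iff_add_le']
      exact h
    -- The sum is recovered as `a + c = (a' ∧ c')'`. With common part `u - (a + c)`, the complements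
    -- `a'` and `c'` leave remainders `c` and `a`.
    have hcomm : (b.perp a : V) ∈ b.C (b.perp c) := by
      refine mackeyCompatible_iff.1 ⟨c, a, u - (a + c), b.proj_nonneg c, b.proj_nonneg a,
        sub_nonneg.2 h, ?_, ?_, ?_⟩
      · rw [add_comm (c : V), add_sub_cancel]
      · rw [coe_perp]
        abel
      · rw [coe_perp]
        abel
    obtain ⟨r, hr, -⟩ := exists_inf hcomm
    have := perp_mem_PC (inf_mem_PC hu hcomm hr (perp_mem_PC ha) (perp_mem_PC hc))
    rw [coe_perp, hr, coe_perp, map_sub, b.focus, b.J_eq_self _ (b.proj_nonneg c) hac,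
      coe_perp] at this
    rwa [sub_sub, sub_sub_cancel] at this

theorem mem_C_of_mem_bicommutant {Q : Set V} {p : b.P} (h : (p : V) ∈ b.bicommutant Q) {g : V}
    (hg : g ∈ Q) : g ∈ b.C p := mem_PC_iff.1 h g (Or.inr hg)

theorem mem_C_of_mem_PC {Q : Set V} {p : b.P} (h : (p : V) ∈ b.bicommutant Q) {q : V}
    (hq : q ∈ b.PC Q) : q ∈ b.C p := mem_PC_iff.1 h q (Or.inl hq)

theorem bicommutant_subset_PC (Q : Set V) : b.bicommutant Q ⊆ b.PC Q :=
  fun _ ⟨h, h'⟩ => ⟨h, fun g hg => h' g (Or.inr hg)⟩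

theorem mem_C_of_mem_bicommutant_of_mem_bicommutant {Q : Set V} {p q : b.P}
    (hp : (p : V) ∈ b.bicommutant Q) (hq : (q : V) ∈ b.bicommutant Q) : (p : V) ∈ b.C q :=
  mem_C_of_mem_PC hq (bicommutant_subset_PC Q hp)

theorem bicommutant_subset {Q R : Set V} (h : b.PC R ⊆ b.PC Q)
    (h' : ∀ p : b.P, (p : V) ∈ b.bicommutant Q → ∀ g ∈ R, g ∈ b.C p) :
    b.bicommutant Q ⊆ b.bicommutant R := by
  intro p hp
  lift p to b.P using hp.1
  refine mem_PC_iff.2 ?_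
  rintro g (hg | hg)
  · exact mem_C_of_mem_PC hp (h hg)
  · exact h' p hp g hg

theorem mem_PC_singleton {g : V} {p : b.P} : (p : V) ∈ b.PC {g} ↔ g ∈ b.C p := by
  rw [mem_PC_iff]
  simp only [Set.mem_singleton_iff, forall_eq]

theorem PC_singleton_subset {g h : V} (H : ∀ p : b.P, g ∈ b.C p → h ∈ b.C p) :
    b.PC {g} ⊆ b.PC {h} := by
  intro p hp
  lift p to b.P using hp.1
  exact mem_PC_singleton.2 (H p (mem_PC_singleton.1 hp))

theorem bicommutant_singleton_subset {g h : V} (H : ∀ p : b.P, g ∈ b.C p ↔ h ∈ b.C p) :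
    b.bicommutant {g} ⊆ b.bicommutant {h} :=
  bicommutant_subset (PC_singleton_subset fun p => (H p).2) fun p hp k hk => by
    rw [Set.mem_singleton_iff.1 hk, ← H]
    exact mem_C_of_mem_bicommutant hp rfl

/-- Binary expansion: under general comparability a positive element is approximated from below
by linear combinations of projections in its bicommutant. -/
theorem GeneralComparability.exists_approx
    (hb : b.GeneralComparability) (n : ℕ) {M : ℝ} {g : V} (hg : 0 ≤ g) (hM : g ≤ M • u) :
    ∃ s ∈ Submodule.span ℝ (b.bicommutant {g}), 0 ≤ g - s ∧ g - s ≤ ((1 / 2) ^ n * M) • u := by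
  induction n generalizing M g with
  | zero => exact ⟨0, Submodule.zero_mem _, by simpa using hg, by simpa using hM⟩
  | succ n ih =>
    -- One binary digit: `p` marks where `g` exceeds `M/2`. Subtracting `(M/2) p` leaves a remainder
    -- between `0` and `(M/2) u`.
    obtain ⟨p, hp, h₁, h₂⟩ := hb (g - (M / 2) • u)
    have hC : ∀ q : b.P, g - (M / 2) • u ∈ b.C q ↔ g ∈ b.C q := fun q => by
      have := smul_sub_smul_unit_mem_C (p := q) (g := g) (r := 1) (s := M / 2) one_ne_zero
      rwa [one_smul] at this
    have hp : (p : V) ∈ b.bicommutant {g} := bicommutant_singleton_subset hC hp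
    have hgp : g ∈ b.C p := mem_C_of_mem_bicommutant hp rfl
    rw [map_sub, map_smul, b.focus] at h₁ h₂
    have hJ : b.J p g ≤ M • p := by
      have := b.J_mono p hM
      rwa [map_smul, b.focus] at this
    set g₁ := g - (M / 2) • (p : V) with hg₁
    have hdec : g₁ = (b.J p g - (M / 2) • (p : V)) + b.J (b.perp p) g := by
      rw [hg₁]
      nth_rw 1 [mem_C_iff.1 hgp]
      abel
    have h0 : 0 ≤ g₁ := by
      rw [hdec]
      exact add_nonneg h₂ (b.J_nonneg _ hg)
    have hM₁ : g₁ ≤ (M / 2) • u := by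
      have e : (M / 2) • u = (M • (p : V) - (M / 2) • (p : V)) + (M / 2) • (b.perp p : V) := by
        rw [coe_perp, ← sub_smul, smul_sub, sub_half]
        abel
      rw [hdec, e]
      exact add_le_add (sub_le_sub_right hJ _) (sub_nonpos.1 h₁)
    -- Keeps later digits inside `P(g)`: whatever commutes with `g` commutes with `p ∈ P(g)`, hence
    -- with the remainder.
    have hsub : b.bicommutant {g₁} ⊆ b.bicommutant {g} := by
      have hpg₁ : (p : V) ∈ b.PC {g₁} := mem_PC_singleton.2
        ((b.commutant p).sub_mem hgp ((b.commutant p).smul_mem _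
          (mem_C_of_mem_bicommutant_of_mem_bicommutant hp hp)))
      refine bicommutant_subset (PC_singleton_subset fun q hq => ?_) fun q hq k hk => ?_
      · exact (b.commutant q).sub_mem hq ((b.commutant q).smul_mem _
          (mem_C_symm (mem_C_of_mem_PC hp (mem_PC_singleton.2 hq))))
      · rw [Set.mem_singleton_iff.1 hk]
        have := (b.commutant q).add_mem (mem_C_of_mem_bicommutant hq (Set.mem_singleton g₁))
          ((b.commutant q).smul_mem (M / 2) (mem_C_of_mem_PC hq hpg₁))
        rwa [hg₁, sub_add_cancel] at this
    obtain ⟨s, hs, hs₁, hs₂⟩ := ih h0 hM₁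
    refine ⟨s + (M / 2) • (p : V), Submodule.add_mem _ (Submodule.span_mono hsub hs)
      (Submodule.smul_mem _ _ (Submodule.subset_span hp)), ?_, ?_⟩
    · rwa [hg₁, sub_sub, add_comm] at hs₁
    · have e : (1 / 2 : ℝ) ^ (n + 1) * M = (1 / 2) ^ n * (M / 2) := by ring
      rw [hg₁, sub_sub, add_comm] at hs₂
      rwa [e]

/-- Under general comparability an element commutes with a projection as soon as its bicommutant
does. -/
theorem GeneralComparability.mem_C_of_bicommutant_subset (hu : IsOrderUnitSpace u)
    (hb : b.GeneralComparability) {g : V} (hg : 0 ≤ g) {p : b.P} (h : b.bicommutant {g} ⊆ b.C p) :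
    g ∈ b.C p := by
  obtain ⟨M, hM0, -, hM⟩ := hu.exists_bound g
  have hMu : 0 ≤ M • u := smul_nonneg hM0.le hu.nonneg
  -- The commutation defect is linear and vanishes on the span of `P(g)`, so `g` has the same defect
  -- as the small remainder `g - s`.
  set d := g - (b.J p g + b.J (b.perp p) g) with hd
  have key : ∀ n : ℕ, d ≤ (1 / 2 : ℝ) ^ n • M • u ∧ -d ≤ (1 / 2 : ℝ) ^ n • M • u := by
    intro n
    obtain ⟨s, hs, h₁, h₂⟩ := hb.exists_approx n hg hM
    have hsC : s ∈ b.commutant p := Submodule.span_le.2 h hs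
    have hds : d = (g - s) - (b.J p (g - s) + b.J (b.perp p) (g - s)) := by
      rw [hd, map_sub, map_sub, eq_sub_of_add_eq' (mem_C_iff.1 (mem_commutant.1 hsC)).symm]
      abel
    rw [smul_smul]
    constructor
    · rw [hds]
      exact (sub_le_self _ (add_nonneg (b.J_nonneg _ h₁) (b.J_nonneg _ h₁))).trans h₂
    · rw [hds, neg_sub]
      refine (sub_le_self _ h₁).trans
        ((add_le_add (b.J_mono p h₂) (b.J_mono (b.perp p) h₂)).trans_eq ?_)
      rw [map_smul, map_smul, ← smul_add, ← mem_C_iff.1 (unit_mem_C p)]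
  have hd0 : d = 0 := le_antisymm (hu.le_zero_of_forall_half_pow hMu fun n => (key n).1)
    (neg_nonpos.1 (hu.le_zero_of_forall_half_pow hMu fun n => (key n).2))
  exact sub_eq_zero.1 hd0

theorem GeneralComparability.mem_C_iff_bicommutant_subset (hu : IsOrderUnitSpace u)
    (hb : b.GeneralComparability) {g : V} (hg : 0 ≤ g) {p : b.P} :
    g ∈ b.C p ↔ b.bicommutant {g} ⊆ b.C p := by
  refine ⟨fun h q hq => ?_, hb.mem_C_of_bicommutant_subset hu hg⟩
  lift q to b.P using hq.1
  exact mem_C_symm (mem_C_of_mem_PC hq (mem_PC_singleton.2 h))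

/-- A family of pairwise commuting projections that is closed under meets and complements is a
Boolean algebra. -/
theorem exists_booleanAlgebra (hu : IsOrderUnitSpace u) {B : Type*} (ψ : B → b.P)
    (hψ : Function.Injective ψ) (hC : ∀ x y, (ψ x : V) ∈ b.C (ψ y))
    (hinf : ∀ x y, ∃ z, (ψ z : V) = b.J (ψ x) (ψ y)) (hcompl : ∀ x, ∃ z, ψ z = b.perp (ψ x))
    (hzero : ∃ z, (ψ z : V) = 0) :
    ∃ _ : BooleanAlgebra B, (∀ x y : B, x ≤ y ↔ (ψ x : V) ≤ ψ y) ∧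
      ∀ x : B, ψ xᶜ = b.perp (ψ x) := by
  choose m hm using hinf
  choose n hn using hcompl
  obtain ⟨o, ho⟩ := hzero
  have hnn : ∀ x, n (n x) = x := fun x => hψ (by rw [hn, hn, perp_perp])
  have hn_le : ∀ {x y}, (ψ x : V) ≤ ψ y → (ψ (n y) : V) ≤ ψ (n x) := fun h => by
    rw [hn, hn]
    exact b.perp_le_perp h
  have hn_le' : ∀ {x y}, (ψ (n x) : V) ≤ ψ y → (ψ (n y) : V) ≤ ψ x := fun h => by
    simpa only [hnn] using hn_le h
  have hn_le'' : ∀ {x y}, (ψ x : V) ≤ ψ (n y) → (ψ y : V) ≤ ψ (n x) := fun h => by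
    simpa only [hnn] using hn_le h
  have hm_left : ∀ x y, (ψ (m x y) : V) ≤ ψ x := fun x y => by
    rw [hm]
    exact b.J_le _ (b.proj_le _)
  have hm_right : ∀ x y, (ψ (m x y) : V) ≤ ψ y := fun x y => by
    rw [hm, J_proj_comm (hC y x)]
    exact b.J_le _ (b.proj_le _)
  have hle_m : ∀ x y z, (ψ x : V) ≤ ψ y → (ψ x : V) ≤ ψ z → (ψ x : V) ≤ ψ (m y z) := by
    intro x y z h₁ h₂
    rw [hm, ← b.J_eq_self (ψ y) (b.proj_nonneg (ψ x)) h₁]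
    exact b.J_mono _ h₂
  -- The De Morgan join equals `x + y - x ∧ y`, which reduces distributivity to linearity of `J_x`.
  have hsup : ∀ x y, (ψ (n (m (n x) (n y))) : V) = ψ x + ψ y - b.J (ψ x) (ψ y) := by
    intro x y
    rw [hn, coe_perp, hm, hn, hn, coe_perp, map_sub, b.focus, coe_perp]
    have h := mem_C_iff.1 (hC y x)
    rw [eq_sub_of_add_eq' h.symm]
    abel
  let _ : PartialOrder B := PartialOrder.lift (fun x => (ψ x : V))
    fun x y h => hψ (Subtype.ext h)
  let _ : Lattice B :=
    { (inferInstance : PartialOrder B) with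
      inf := m
      sup := fun x y => n (m (n x) (n y))
      inf_le_left := hm_left
      inf_le_right := hm_right
      le_inf := hle_m
      le_sup_left := fun x y => hn_le'' (hm_left (n x) (n y))
      le_sup_right := fun x y => hn_le'' (hm_right (n x) (n y))
      sup_le := fun x y z h₁ h₂ => hn_le' (hle_m _ _ _ (hn_le h₁) (hn_le h₂)) }
  let _ : DistribLattice B := DistribLattice.ofInfSupLe fun x y z => by
    change (ψ (m x (n (m (n y) (n z)))) : V) ≤ ψ (n (m (n (m x y)) (n (m x z))))
    -- Both sides become `J_x y + J_x z - J_x J_y z`.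
    rw [hsup, hm, hsup, map_sub, map_add, hm, hm, J_eq_comp (hC x y) (hm x y),
      J_comm (hC y x), J_comp_of_le hu le_rfl, ← J_comm (hC y x), J_comm (hC y x)]
  exact ⟨{ (inferInstance : DistribLattice B) with
      compl := n
      top := n o
      bot := o
      le_top := fun x => by
        change (ψ x : V) ≤ ψ (n o)
        rw [hn, coe_perp, ho, sub_zero]
        exact b.proj_le _
      bot_le := fun x => by
        change (ψ o : V) ≤ ψ x
        rw [ho]
        exact b.proj_nonneg _
      inf_compl_le_bot := fun x => by
        change (ψ (m x (n x)) : V) ≤ ψ o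
        rw [hm, hn, ho, b.J_eq_zero _ (b.proj_nonneg _) le_rfl]
      top_le_sup_compl := fun x => by
        change (ψ (n o) : V) ≤ ψ (n (m (n x) (n (n x))))
        refine hn_le ?_
        rw [hm, hn (n x), ho, b.J_eq_zero _ (b.proj_nonneg _) le_rfl] },
    fun _ _ => Iff.rfl, hn⟩

end CompressionBase

end OrderUnit

/-! ### Comparability, projection covers and the Rickart property. -/

namespace OrderUnit.CompressionBase

variable {V : Type*} [AddCommGroup V] [PartialOrder V] [IsOrderedAddMonoid V]
  [Module ℝ V] [IsOrderedModule ℝ V] {u : V} {b : CompressionBase u}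

theorem GeneralComparability.rickart (hu : IsOrderUnitSpace u) (hb : b.GeneralComparability)
    (hcover : ∀ a ∈ Set.Icc 0 u, ∃ p : b.P, ∀ q : b.P, a ≤ q ↔ (p : V) ≤ q) : b.Rickart := by
  suffices h : ∀ g : V, ∃ s : b.P, ∀ p : b.P, (p : V) ≤ s ↔ g ∈ b.C p ∧ b.J p g = 0 by
    choose star hstar using h
    exact ⟨star, hstar⟩
  intro g
  obtain ⟨p, hp, hneg, hpos⟩ := hb g
  have hgp : g ∈ b.C p := mem_C_of_mem_bicommutant hp rfl
  have hneg' : 0 ≤ -b.J (b.perp p) g := neg_nonneg.2 hneg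
  -- The sum `J_p g + (-J_{p'} g)` plays the role of `|g|`; `a` is a multiple of it in `[0, u]`, and
  -- `g*` is the complement of its cover.
  obtain ⟨r, hr, a, ha, hra⟩ := hu.exists_eq_smul (add_nonneg hpos hneg')
  obtain ⟨c, hc⟩ := hcover a ha
  have hzero : ∀ s : b.P, b.J s a = 0 ↔ b.J s (b.J p g) = 0 ∧ b.J s (b.J (b.perp p) g) = 0 := by
    intro s
    have h := congrArg (b.J s) hra
    rw [map_smul, map_add] at h
    rw [← smul_eq_zero_iff_right hr.ne', ← h, add_eq_zero_iff_of_nonneg (b.J_nonneg s hpos)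
      (b.J_nonneg s hneg'), map_neg, neg_eq_zero]
  refine ⟨b.perp c, fun s => ?_⟩
  have h₁ : (s : V) ≤ b.perp c ↔ (c : V) ≤ b.perp s := by
    rw [coe_perp, coe_perp, le_sub_comm]
  rw [h₁, ← hc, ← b.J_eq_zero_iff s ha.1 ha.2, hzero]
  constructor
  · rintro ⟨h₂, h₃⟩
    have hs : b.J s g = 0 := by
      rw [mem_C_iff.1 hgp, map_add, h₂, h₃, add_zero]
    -- A positive element killed by `J_s` is a multiple of an element below `s'`, which `J_{s'}`
    -- fixes; hence it commutes with `s`.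
    have key : ∀ v, 0 ≤ v → b.J s v = 0 → v ∈ b.C s := by
      intro v hv h
      obtain ⟨t, ht, e, he, rfl⟩ := hu.exists_eq_smul hv
      rw [map_smul, smul_eq_zero_iff_right ht.ne'] at h
      refine (b.commutant s).smul_mem t (mem_C_iff.2 ?_)
      rw [h, zero_add, b.J_eq_self _ he.1 ((b.J_eq_zero_iff s he.1 he.2).1 h)]
    refine ⟨?_, hs⟩
    have := (b.commutant s).sub_mem (key _ hpos h₂) (key _ hneg' (by rw [map_neg, h₃, neg_zero]))
    rw [sub_neg_eq_add, ← mem_C_iff.1 hgp] at this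
    exact this
  · rintro ⟨h₂, h₃⟩
    -- As `s` commutes with `g`, it commutes with `p ∈ P(g)`, so `J_s` can be moved past `J_p` and
    -- `J_{p'}` onto `g`.
    have hsp : (s : V) ∈ b.C p := mem_C_of_mem_PC hp (mem_PC_singleton.2 h₂)
    rw [J_comm hsp, J_comm (mem_C_perp.2 hsp), h₃, map_zero, map_zero]
    exact ⟨rfl, rfl⟩

theorem Rickart.exists_cover (hb : b.Rickart) {a : V} (ha : a ∈ Set.Icc 0 u) :
    ∃ p : b.P, ∀ q : b.P, a ≤ q ↔ (p : V) ≤ q := by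
  obtain ⟨star, hstar⟩ := hb
  refine ⟨b.perp (star a), fun q => ?_⟩
  have h₁ : (b.perp (star a) : V) ≤ q ↔ (b.perp q : V) ≤ star a := by
    rw [coe_perp, coe_perp, sub_le_comm]
  rw [h₁, hstar, b.J_eq_zero_iff _ ha.1 ha.2, perp_perp]
  refine ⟨fun h => ⟨mem_C_perp.2 (mem_C_iff.2 ?_), h⟩, fun h => h.2⟩
  rw [b.J_eq_self q ha.1 h, b.J_perp_eq_zero q ha.1 h, add_zero]

/-- Comparability of commuting positive elements. -/
theorem GeneralComparability.exists_comparison (hu : IsOrderUnitSpace u)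
    (hb : b.GeneralComparability) {e f : V} (he : 0 ≤ e) (hf : 0 ≤ f)
    (hef : ∀ p ∈ b.bicommutant {e}, ∀ q ∈ b.bicommutant {f}, MackeyCompatible u p q) :
    ∃ p : b.P, (p : V) ∈ b.bicommutant {e, f} ∧ b.J p e ≤ b.J p f ∧
      b.J (b.perp p) f ≤ b.J (b.perp p) e := by
  obtain ⟨p, hp, h₁, h₂⟩ := hb (e - f)
  rw [map_sub] at h₁ h₂
  -- Any `r ∈ P(g)` commutes with `g` and with all of `P(h)`, hence with `h` and with `e - f`. So `q
  -- ∈ P(e - f)` commutes with all of `P(g)`, and therefore with `g`.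
  have hsub : ∀ {g h : V}, 0 ≤ g → 0 ≤ h →
      (∀ p ∈ b.bicommutant {g}, ∀ q ∈ b.bicommutant {h}, MackeyCompatible u p q) →
      (∀ q : b.P, g ∈ b.C q → h ∈ b.C q → e - f ∈ b.C q) →
      ∀ q : b.P, (q : V) ∈ b.bicommutant {e - f} → g ∈ b.C q := by
    intro g h hg hh hgh hC q hq
    refine hb.mem_C_of_bicommutant_subset hu hg fun r hr => ?_
    lift r to b.P using hr.1
    refine mem_C_of_mem_PC hq (mem_PC_singleton.2 (hC r (mem_C_of_mem_bicommutant hr rfl) ?_))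
    refine hb.mem_C_of_bicommutant_subset hu hh fun t ht => ?_
    lift t to b.P using ht.1
    exact mackeyCompatible_iff.1 (hgh r hr t ht).symm
  have hpef : (p : V) ∈ b.bicommutant {e, f} := by
    refine bicommutant_subset (fun q hq => ?_) (fun q hq => ?_) hp
    · lift q to b.P using hq.1
      rw [mem_PC_iff] at hq
      exact mem_PC_singleton.2 ((b.commutant q).sub_mem (hq e (by simp)) (hq f (by simp)))
    · simp only [Set.mem_insert_iff, Set.mem_singleton_iff, forall_eq_or_imp, forall_eq]
      exact ⟨hsub he hf hef (fun q h h' => (b.commutant q).sub_mem h h') q hq,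
        hsub hf he (fun q hq p hp => (hef p hp q hq).symm)
          (fun q h h' => (b.commutant q).sub_mem h' h) q hq⟩
  refine ⟨b.perp p, perp_mem_PC hpef, sub_nonpos.1 h₁, ?_⟩
  rw [perp_perp]
  exact sub_nonneg.1 h₂

/-- General comparability follows from the comparability of elements of the unit interval with
half the unit. -/
theorem generalComparability_of_comparison (hu : IsOrderUnitSpace u)
    (h : ∀ e ∈ Set.Icc 0 u, ∀ f ∈ Set.Icc 0 u,
      (∀ p ∈ b.bicommutant {e}, ∀ q ∈ b.bicommutant {f}, MackeyCompatible u p q) →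
      ∃ p : b.P, (p : V) ∈ b.bicommutant {e, f} ∧ b.J p e ≤ b.J p f ∧
        b.J (b.perp p) f ≤ b.J (b.perp p) e) : b.GeneralComparability := by
  intro g
  obtain ⟨r, hr, hrg, hgr⟩ := hu.exists_bound g
  have h2r : 0 < 2 * r := by positivity
  set f : V := (1 / 2 : ℝ) • u
  have hfC : ∀ p : b.P, f ∈ b.C p := fun p => (b.commutant p).smul_mem _ (unit_mem_C p)
  -- From `-r u ≤ g ≤ r u`, this affine change of scale puts `e` in `[0, u]`, with `e - f = g /
  -- (2r)`.
  set e : V := (2 * r)⁻¹ • (g + r • u) with he_def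
  have he : e ∈ Set.Icc 0 u := IsOrderUnitSpace.inv_smul_mem (neg_le_iff_add_nonneg.1 hrg) h2r (by
    rw [two_mul, add_smul]
    exact add_le_add_left hgr _)
  have hf : f ∈ Set.Icc 0 u := ⟨smul_nonneg (by norm_num) hu.nonneg,
    smul_le_of_le_one_left hu.nonneg (by norm_num)⟩
  have hg : g = (2 * r) • (e - f) := by
    rw [he_def, smul_sub, smul_inv_smul₀ h2r.ne', smul_smul, mul_one_div,
      mul_div_cancel_left₀ _ two_ne_zero, add_sub_cancel_right]
  have hge : ∀ p : b.P, e ∈ b.C p ↔ g ∈ b.C p := by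
    intro p
    have h₁ := (b.commutant p).sub_mem_iff_left (x := e) (hfC p)
    rw [← (b.commutant p).smul_mem_iff h2r.ne', ← hg] at h₁
    exact h₁.symm
  obtain ⟨p, hp, h₁, h₂⟩ := h e he f hf fun p hp q hq => by
    lift p to b.P using hp.1
    lift q to b.P using hq.1
    exact mackeyCompatible_iff.2 (mem_C_of_mem_PC hq (mem_PC_singleton.2 (hfC p)))
  have hpg : (p : V) ∈ b.bicommutant {g} := by
    refine bicommutant_subset (fun q hq => ?_) (fun q hq => ?_) hp
    · lift q to b.P using hq.1
      rw [mem_PC_singleton, ← hge] at hq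
      refine mem_PC_iff.2 ?_
      simp only [Set.mem_insert_iff, Set.mem_singleton_iff, forall_eq_or_imp, forall_eq]
      exact ⟨hq, hfC q⟩
    · simp only [Set.mem_singleton_iff, forall_eq, ← hge]
      exact mem_C_of_mem_bicommutant hq (by simp)
  refine ⟨b.perp p, perp_mem_PC hpg, ?_, ?_⟩
  · rw [perp_perp, hg, map_smul, map_sub]
    exact smul_nonpos_of_nonneg_of_nonpos h2r.le (sub_nonpos.2 h₁)
  · rw [hg, map_smul, map_sub]
    exact smul_nonneg h2r.le (sub_nonneg.2 h₂)

end OrderUnit.CompressionBase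

/-! ### Transfer of commutants and of spectrality between `E` and `V`. -/

namespace IntervalIso.ExtendsBase

open EffectAlgebra ConvexEffectAlgebra

variable {E : Type*} [EffectAlgebra E] [ConvexEffectAlgebra E]
  {V : Type*} [AddCommGroup V] [PartialOrder V] [IsOrderedAddMonoid V]
  [Module ℝ V] [IsOrderedModule ℝ V] {u : V} {φ : IntervalIso E V u}
  {b : EffectAlgebra.CompressionBase E} {c : OrderUnit.CompressionBase u}

theorem map_mem (h : φ.ExtendsBase b c) {p : E} (hp : p ∈ b.P) : φ.toFun p ∈ c.P :=
  h.1 ▸ Set.mem_image_of_mem _ hp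

/-- The projection of `V` corresponding to a projection of `E`. -/
def proj (h : φ.ExtendsBase b c) (p : b.P) : c.P := ⟨φ.toFun p, h.map_mem p.2⟩

theorem exists_eq_proj (h : φ.ExtendsBase b c) (q : c.P) : ∃ p, h.proj p = q := by
  have hq : (q : V) ∈ φ.toFun '' b.P := h.1 ▸ q.2
  obtain ⟨p, hp, hpq⟩ := hq
  exact ⟨⟨p, hp⟩, Subtype.ext hpq⟩

theorem J_proj (h : φ.ExtendsBase b c) (p : b.P) (a : E) :
    c.J (h.proj p) (φ.toFun a) = φ.toFun (b.J p a) := h.2 p (h.proj p) rfl a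

theorem proj_perp (h : φ.ExtendsBase b c) (p : b.P) : h.proj (b.perp p) = c.perp (h.proj p) :=
  Subtype.ext (φ.map_compl p)

theorem mem_C_iff (h : φ.ExtendsBase b c) {p : b.P} {a : E} :
    a ∈ b.C p ↔ φ.toFun a ∈ c.C (h.proj p) := by
  rw [OrderUnit.CompressionBase.mem_C_iff, ← h.proj_perp, h.J_proj, h.J_proj]
  exact φ.osum_eq_some_iff

theorem mem_PC_iff (h : φ.ExtendsBase b c) {A : Set E} {p : b.P} :
    (p : E) ∈ b.PC A ↔ (h.proj p : V) ∈ c.PC (φ.toFun '' A) := by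
  rw [OrderUnit.CompressionBase.mem_PC_iff, Set.forall_mem_image]
  simp only [← h.mem_C_iff]
  exact ⟨fun ⟨_, hp⟩ => hp, fun hp => ⟨p.2, hp⟩⟩

theorem image_PC (h : φ.ExtendsBase b c) (A : Set E) :
    φ.toFun '' b.PC A = c.PC (φ.toFun '' A) := by
  ext v
  constructor
  · rintro ⟨p, hp, rfl⟩
    lift p to b.P using hp.1
    exact h.mem_PC_iff.1 hp
  · intro hv
    obtain ⟨p, hp⟩ := h.exists_eq_proj ⟨v, hv.1⟩
    obtain rfl : (h.proj p : V) = v := congrArg Subtype.val hp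
    exact ⟨p, h.mem_PC_iff.2 hv, rfl⟩

theorem image_bicommutant (h : φ.ExtendsBase b c) (A : Set E) :
    φ.toFun '' b.bicommutant A = c.bicommutant (φ.toFun '' A) := by
  rw [CompressionBase.bicommutant, h.image_PC, Set.image_union, h.image_PC]
  rfl

theorem image_bicommutant_singleton (h : φ.ExtendsBase b c) (a : E) :
    φ.toFun '' b.bicommutant {a} = c.bicommutant {φ.toFun a} := by
  rw [h.image_bicommutant, Set.image_singleton]

theorem image_bicommutant_pair (h : φ.ExtendsBase b c) (e f : E) :
    φ.toFun '' b.bicommutant {e, f} = c.bicommutant {φ.toFun e, φ.toFun f} := by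
  rw [h.image_bicommutant, Set.image_pair]

theorem proj_mem_bicommutant_pair (h : φ.ExtendsBase b c) {p : b.P} {e f : E} :
    (h.proj p : V) ∈ c.bicommutant {φ.toFun e, φ.toFun f} ↔ (p : E) ∈ b.bicommutant {e, f} := by
  rw [← h.image_bicommutant_pair]
  exact φ.injective.mem_set_image

theorem commutes_iff (h : φ.ExtendsBase b c) {e f : E} : b.Commutes e f ↔
    ∀ p ∈ c.bicommutant {φ.toFun e}, ∀ q ∈ c.bicommutant {φ.toFun f},
      OrderUnit.MackeyCompatible u p q := by
  rw [← h.image_bicommutant_singleton, ← h.image_bicommutant_singleton]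
  simp only [Set.forall_mem_image, ← φ.mackeyCompatible_iff]
  rfl

theorem comparison_iff (h : φ.ExtendsBase b c) {e f : E} :
    (∃ p : b.P, (p : E) ∈ b.bicommutant {e, f} ∧
      Le (b.J p e) (b.J p f) ∧ Le (b.J (b.perp p) f) (b.J (b.perp p) e)) ↔
    ∃ p : c.P, (p : V) ∈ c.bicommutant {φ.toFun e, φ.toFun f} ∧
      c.J p (φ.toFun e) ≤ c.J p (φ.toFun f) ∧
      c.J (c.perp p) (φ.toFun f) ≤ c.J (c.perp p) (φ.toFun e) := by
  have key : ∀ p : b.P, ((p : E) ∈ b.bicommutant {e, f} ∧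
      Le (b.J p e) (b.J p f) ∧ Le (b.J (b.perp p) f) (b.J (b.perp p) e)) ↔
      (h.proj p : V) ∈ c.bicommutant {φ.toFun e, φ.toFun f} ∧
      c.J (h.proj p) (φ.toFun e) ≤ c.J (h.proj p) (φ.toFun f) ∧
      c.J (c.perp (h.proj p)) (φ.toFun f) ≤ c.J (c.perp (h.proj p)) (φ.toFun e) := fun p => by
    rw [← h.proj_perp, h.J_proj, h.J_proj, h.J_proj, h.J_proj, φ.le_iff, φ.le_iff,
      h.proj_mem_bicommutant_pair]
  constructor
  · rintro ⟨p, hp⟩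
    exact ⟨_, (key p).1 hp⟩
  · rintro ⟨q, hq⟩
    obtain ⟨p, rfl⟩ := h.exists_eq_proj q
    exact ⟨p, (key p).2 hq⟩

theorem projectionCover_iff (h : φ.ExtendsBase b c) : b.ProjectionCover ↔
    ∀ a ∈ Set.Icc 0 u, ∃ p : c.P, ∀ q : c.P, a ≤ q ↔ (p : V) ≤ q := by
  have key : ∀ (a : E) (p : b.P), (∀ q : b.P, Le a (q : E) ↔ Le (p : E) (q : E)) ↔
      ∀ q : c.P, φ.toFun a ≤ q ↔ (h.proj p : V) ≤ q := by
    intro a p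
    simp only [φ.le_iff]
    refine ⟨fun H q => ?_, fun H q => H (h.proj q)⟩
    obtain ⟨q, rfl⟩ := h.exists_eq_proj q
    exact H q
  constructor
  · intro H v hv
    obtain ⟨a, rfl⟩ := φ.surj v hv
    obtain ⟨p, hp⟩ := H a
    exact ⟨_, (key a p).1 hp⟩
  · intro H a
    obtain ⟨q, hq⟩ := H _ (φ.mem_Icc a)
    obtain ⟨p, rfl⟩ := h.exists_eq_proj q
    exact ⟨p, (key a p).2 hq⟩

theorem isSubEffectAlgebra_PC (h : φ.ExtendsBase b c) (hu : OrderUnit.IsOrderUnitSpace u)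
    (A : Set E) : IsSubEffectAlgebra (b.PC A) := by
  have := φ.isSubEffectAlgebra_preimage
    (OrderUnit.CompressionBase.isSubEffectAlgebra_PC (b := c) hu (φ.toFun '' A))
  rwa [← h.image_PC, φ.injective.preimage_image] at this

theorem isBooleanSubalgebra_bicommutant (h : φ.ExtendsBase b c)
    (hu : OrderUnit.IsOrderUnitSpace u) (A : Set E) : IsBooleanSubalgebra (b.bicommutant A) := by
  have hsub : IsSubEffectAlgebra (b.bicommutant A) := h.isSubEffectAlgebra_PC hu _
  let ψ : b.bicommutant A → c.P := fun x => h.proj ⟨x, x.2.1⟩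
  have hψ : Function.Injective ψ := fun x y hxy =>
    Subtype.ext (φ.injective (congrArg Subtype.val hxy))
  have hmem : ∀ x, (ψ x : V) ∈ c.bicommutant (φ.toFun '' A) := fun x => by
    rw [← h.image_bicommutant]
    exact ⟨x, x.2, rfl⟩
  have hex : ∀ q : c.P, (q : V) ∈ c.bicommutant (φ.toFun '' A) → ∃ z, ψ z = q := fun q hq => by
    rw [← h.image_bicommutant] at hq
    obtain ⟨p, hp, hpq⟩ := hq
    exact ⟨⟨p, hp⟩, Subtype.ext hpq⟩
  have hC : ∀ x y, (ψ x : V) ∈ c.C (ψ y) := fun x y =>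
    OrderUnit.CompressionBase.mem_C_of_mem_bicommutant_of_mem_bicommutant (hmem x) (hmem y)
  obtain ⟨inst, hle, hcompl⟩ := OrderUnit.CompressionBase.exists_booleanAlgebra hu ψ hψ hC
    (fun x y => by
      obtain ⟨r, hr, -⟩ := OrderUnit.CompressionBase.exists_inf (hC x y)
      obtain ⟨z, rfl⟩ := hex r
        (OrderUnit.CompressionBase.inf_mem_PC hu (hC x y) hr (hmem x) (hmem y))
      exact ⟨z, hr⟩)
    (fun x => hex _ (OrderUnit.CompressionBase.perp_mem_PC (hmem x)))
    ⟨⟨zero, hsub.zero_mem⟩, φ.map_zero⟩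
  refine ⟨hsub, inst, fun x y => (hle x y).trans φ.le_iff.symm, fun x => φ.injective ?_⟩
  rw [φ.map_compl]
  exact congrArg Subtype.val (hcompl x)

/-- A compression base on a convex effect algebra is spectral if and only if its extension to the
order unit space is. -/
theorem isSpectral_iff (h : φ.ExtendsBase b c) (hu : OrderUnit.IsOrderUnitSpace u) :
    b.IsSpectral ↔ c.IsSpectral := by
  constructor
  · rintro ⟨⟨-, hcomp⟩, hcover⟩
    have hgc : c.GeneralComparability :=
      OrderUnit.CompressionBase.generalComparability_of_comparison hu fun e he f hf hef => by
        obtain ⟨e, rfl⟩ := φ.surj e he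
        obtain ⟨f, rfl⟩ := φ.surj f hf
        exact h.comparison_iff.1 (hcomp e f (h.commutes_iff.2 hef))
    exact ⟨hgc, hgc.rickart hu (h.projectionCover_iff.1 hcover)⟩
  · rintro ⟨hgc, hr⟩
    -- The Boolean subalgebra witnessing the b-property of `a` is `P(a)` itself.
    refine ⟨⟨fun a => ⟨b.bicommutant {a}, fun p hp => hp.1,
      h.isBooleanSubalgebra_bicommutant hu _, fun p => ?_⟩, fun e f hef => ?_⟩,
      h.projectionCover_iff.2 fun a ha => hr.exists_cover ha⟩
    · rw [h.mem_C_iff, hgc.mem_C_iff_bicommutant_subset hu (φ.mem_Icc a).1,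
        ← h.image_bicommutant_singleton, Set.image_subset_iff]
      exact forall_congr' fun q => imp_congr_right fun _ => h.mem_C_iff.symm
    · exact h.comparison_iff.2 (hgc.exists_comparison hu (φ.mem_Icc e).1 (φ.mem_Icc f).1
        (h.commutes_iff.1 hef))

end IntervalIso.ExtendsBase

/-- Every convex, strongly archimedean effect algebra `E` is affinely isomorphic to the unit
interval of an order unit space, and for every such order unit space: compressions, and
compression bases, on `E` and on `V` correspond to each other by unique extension and
restriction; `E` is spectral with respect to a compression base iff `V` is spectral with
respect to the corresponding one; and so some compression base makes `E` spectral iff some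
compression base makes `V` spectral. -/
theorem mainTheorem11 {E : Type uE} [EffectAlgebra E] [ConvexEffectAlgebra E]
    (hE : ConvexEffectAlgebra.StronglyArchimedean E) :
    (∃ (V : Type uE) (_ : AddCommGroup V) (_ : PartialOrder V) (_ : IsOrderedAddMonoid V)
        (_ : Module ℝ V) (_ : IsOrderedModule ℝ V) (u : V),
        OrderUnit.IsOrderUnitSpace u ∧ Nonempty (IntervalIso E V u)) ∧
    (∀ (V : Type uV) [AddCommGroup V] [PartialOrder V] [IsOrderedAddMonoid V]
        [Module ℝ V] [IsOrderedModule ℝ V] (u : V) (_ : OrderUnit.IsOrderUnitSpace u)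
        (φ : IntervalIso E V u),
      (∀ J : E → E, EffectAlgebra.IsCompression J →
        ∃! L : V →ₗ[ℝ] V, OrderUnit.IsCompression u L ∧ φ.Extends J L) ∧
      (∀ L : V →ₗ[ℝ] V, OrderUnit.IsCompression u L →
        ∃! J : E → E, EffectAlgebra.IsCompression J ∧ φ.Extends J L) ∧
      (∀ b : EffectAlgebra.CompressionBase E,
        ∃! c : OrderUnit.CompressionBase u, φ.ExtendsBase b c) ∧
      (∀ c : OrderUnit.CompressionBase u,
        ∃! b : EffectAlgebra.CompressionBase E, φ.ExtendsBase b c) ∧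
      (∀ (b : EffectAlgebra.CompressionBase E) (c : OrderUnit.CompressionBase u),
        φ.ExtendsBase b c → (b.IsSpectral ↔ c.IsSpectral)) ∧
      ((∃ b : EffectAlgebra.CompressionBase E, b.IsSpectral) ↔
        ∃ c : OrderUnit.CompressionBase u, c.IsSpectral)) := by
  refine ⟨⟨ConvexEffectAlgebra.Envelope E, inferInstance, inferInstance, inferInstance,
    inferInstance, inferInstance, _, ConvexEffectAlgebra.Envelope.isOrderUnitSpace hE,
    ⟨ConvexEffectAlgebra.Envelope.intervalIso E⟩⟩, ?_⟩
  intro V _ _ _ _ _ u hu φ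
  refine ⟨fun J hJ => φ.existsUnique_compression_extension hu hJ,
    fun L hL => φ.existsUnique_compression_restriction hu hL,
    fun b => φ.existsUnique_base_extension hu b,
    fun c => φ.existsUnique_base_restriction hu c, fun b c h => h.isSpectral_iff hu, ?_, ?_⟩
  · rintro ⟨b, hb⟩
    obtain ⟨c, hc, -⟩ := φ.existsUnique_base_extension hu b
    exact ⟨c, (hc.isSpectral_iff hu).1 hb⟩
  · rintro ⟨c, hc⟩
    obtain ⟨b, hb, -⟩ := φ.existsUnique_base_restriction hu c
    exact ⟨b, (hb.isSpectral_iff hu).2 hc⟩
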